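/- Let $\mathbb C^{2|2}$ have basis $f_1,f_2$ (odd), $e_3,e_4$ (even), and write $v_1,v_2,v_3,v_4$ for the corresponding vectors of the parity reversion ($v_1,v_2$ even, $v_3,v_4$ odd). Let $\psi^{i,j}_k\in\mathrm{Hom}(S^2(\Pi\mathbb C^{2|2}),\Pi\mathbb C^{2|2})$ be the map with $v_i\cdot v_j\mapsto v_k$ (hence $v_j\cdot v_i\mapsto(-1)^{|v_i||v_j|}v_k$) that kills all other products of basis vectors. A quadratic codifferential $d$ defines the Lie superalgebra with bracket $[a,b]=(-1)^{|a|}\,\pi\, d(\pi a\cdot\pi b)$, where $\pi$ is the parity reversion and $|a|$ is the parity of $a$ in $\mathbb C^{2|2}$. For $p,q,r\in\mathbb C$ consider $$\begin{aligned} d_1&=\psi^{1,3}_1+\psi^{2,3}_1+2\psi^{2,3}_2+\psi^{2,4}_1+\psi^{2,4}_2,\\ d_2&=\psi^{1,2}_3+4\psi^{1,1}_3+\psi^{1,2}_4+2\psi^{2,2}_4,\\ d_3&=\psi^{1,2}_3+4\psi^{1,1}_3+2\psi^{1,4}_2+\psi^{2,4}_2-\psi^{3,4}_3+\psi^{1,2}_4-\psi^{2,3}_2-\psi^{3,4}_4,\\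 d_4&=8\psi^{1,1}_3+\psi^{1,2}_4+2\psi^{1,1}_4,\\ d_5(p:q)&=\psi^{2,3}_1+(p-q)\psi^{1,4}_1+p\psi^{2,4}_2+q\psi^{3,4}_3,\\ d_6(p:q)&=\psi^{1,2}_3+4\psi^{1,1}_3+q\psi^{1,4}_1+2(p-q)\psi^{1,4}_2+p\psi^{2,4}_2-(p+q)\psi^{3,4}_3,\\ d_7(p:q)&=4\psi^{1,1}_3+p\psi^{1,4}_1+\psi^{1,4}_2+q\psi^{2,4}_2-2p\psi^{3,4}_3,\\ d_8&=4\psi^{1,1}_3+\psi^{1,4}_1+\psi^{2,4}_2-2\psi^{3,4}_3,\\ d_9&=4\psi^{1,1}_3,\\ d_{10}(p:q:r)&=p\psi^{1,4}_1+\psi^{2,4}_1+q\psi^{2,4}_2+r\psi^{3,4}_3,\\ d_{11}(p:q)&=p\psi^{1,4}_1+p\psi^{2,4}_2+q\psi^{3,4}_3. \end{aligned}$$ Here all parameter values are allowed, including $(0:0)$ and $(0:0:0)$; $d_{11}(0:0)$ is the trivial algebra. Isomorphisms are linear bijections that preserve the grading and the bracket. Then: 1. Each of these is a complex Lie superalgebra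 of bidimension $2|2$. 2. Every complex Lie superalgebra of bidimension $2|2$ is isomorphic to a member of the list. 3. The only isomorphisms between members of the list are the following. For every $u\in\mathbb C\setminus\{0\}$, $d_i(p:q)\cong d_i(up:uq)$ for $i=5,6,7,11$, $d_{10}(p:q:r)\cong d_{10}(up:uq:ur)$, $d_6(p:q)\cong d_6(uq:up)$ and $d_{10}(p:q:r)\cong d_{10}(uq:up:ur)$; moreover $d_5(0:0)\cong d_{10}(0:0:0)$; and each member is isomorphic to itself. So, apart from the points with all coordinates zero, $d_5,d_7,d_{11}$ are parametrized by $\mathbb P^1$, $d_6$ by $\mathbb P^1/\Sigma_2$ and $d_{10}$ by $\mathbb P^2/\Sigma_2$, where $\Sigma_2$ exchanges the (first) two coordinates, and members with different names are otherwise not isomorphic. 4. Every complex Lie superalgebra $L$ of bidimension $2|2$ is an extension $0\to M\to L\to W\to 0$ of a one-dimensional trivial algebra $W$ (even or odd) by a graded ideal $M$; that is, it has a graded ideal $M$ of bidimension $1|2$ or $2|1$ that contains all brackets. -/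

import Mathlib

/-- A complex Lie superalgebra structure on the vector space `L`: a `ℤ/2`-grading
`L = L₀ ⊕ L₁` and an even, graded skew-symmetric bilinear bracket that satisfies the graded
Jacobi identity. -/
structure LieSuperalgebra (L : Type*) [AddCommGroup L] [Module ℂ L] where
  part : ZMod 2 → Submodule ℂ L
  isCompl : IsCompl (part 0) (part 1)
  bracket : L →ₗ[ℂ] L →ₗ[ℂ] L
  bracket_mem : ∀ i j : ZMod 2, ∀ x ∈ part i, ∀ y ∈ part j, bracket x y ∈ part (i + j)
  skew : ∀ i j : ZMod 2, ∀ x ∈ part i, ∀ y ∈ part j,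
    bracket x y = -((-1 : ℂ) ^ (i.val * j.val) • bracket y x)
  jacobi : ∀ i j k : ZMod 2, ∀ x ∈ part i, ∀ y ∈ part j, ∀ z ∈ part k,
    bracket x (bracket y z) =
      bracket (bracket x y) z + (-1 : ℂ) ^ (i.val * j.val) • bracket y (bracket x z)

namespace LieSuperalgebra

section

variable {L L' : Type*} [AddCommGroup L] [Module ℂ L] [AddCommGroup L'] [Module ℂ L']

/-- The bidimension of `A` is `m|n`: the even part has dimension `m`, the odd part has
dimension `n` (for positive `m`, `n` this includes finite-dimensionality). -/
def HasBidim (A : LieSuperalgebra L) (m n : ℕ) : Prop :=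
  Module.finrank ℂ (A.part 0) = m ∧ Module.finrank ℂ (A.part 1) = n

/-- Isomorphism of Lie superalgebras: a linear bijection that preserves the grading and the
bracket. -/
def Isomorphic (A : LieSuperalgebra L) (B : LieSuperalgebra L') : Prop :=
  ∃ e : L ≃ₗ[ℂ] L', (∀ i, ∀ x ∈ A.part i, e x ∈ B.part i) ∧
    ∀ x y, e (A.bracket x y) = B.bracket (e x) (e y)

/-- `M` is a graded ideal of `A`: it is spanned by its homogeneous elements and is absorbing
for the bracket. -/
def IsGradedIdeal (A : LieSuperalgebra L) (M : Submodule ℂ L) : Prop :=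
  M = (M ⊓ A.part 0) ⊔ (M ⊓ A.part 1) ∧ ∀ x, ∀ y ∈ M, A.bracket x y ∈ M

/-- `A` is an extension `0 → M → A → W → 0` of an algebra `W` with zero bracket by a graded ideal
`M` of bidimension `m|n`. -/
def IsExtensionOfTrivialBy (A : LieSuperalgebra L) (m n : ℕ) : Prop :=
  ∃ M : Submodule ℂ L, A.IsGradedIdeal M ∧
    Module.finrank ℂ ↥(M ⊓ A.part 0) = m ∧ Module.finrank ℂ ↥(M ⊓ A.part 1) = n ∧
    ∀ x y, A.bracket x y ∈ M

end

namespace TwoTwo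

/-! The space `ℂ²ˡ²` with basis `v1, v2, v3, v4`. As elements of the Lie superalgebra `L`, the vectors
`v1, v2` are odd and `v3, v4` are even; as elements of the parity reversion `ΠL`, on whose
symmetric coalgebra the codifferential lives, `v1, v2` are even and `v3, v4` are odd. -/

abbrev v1 : Fin 4 := 0
abbrev v2 : Fin 4 := 1
abbrev v3 : Fin 4 := 2
abbrev v4 : Fin 4 := 3

/-- Parity of the basis vectors in `L`. -/
def parity : Fin 4 → ZMod 2 := ![1, 1, 0, 0]

/-- Parity of the basis vectors in `ΠL`. -/
def piParity (i : Fin 4) : ZMod 2 := parity i + 1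

/-- The homogeneous parts of `L`. -/
def part (i : ZMod 2) : Submodule ℂ (Fin 4 → ℂ) where
  carrier := {x | ∀ k, parity k ≠ i → x k = 0}
  zero_mem' := by intro k _; rfl
  add_mem' := by
    intro a b ha hb k hk
    simp [ha k hk, hb k hk]
  smul_mem' := by
    intro c a ha k hk
    simp [ha k hk]

/-- The element `ψ^{i,j}_k` of `Hom(S²(ΠL), ΠL)`: it sends `v_i · v_j` to `v_k`, hence
`v_j · v_i` to `(-1)^{|v_i||v_j|} v_k`, and all other products of basis vectors to `0`. -/
def psi (i j k : Fin 4) : (Fin 4 → ℂ) →ₗ[ℂ] (Fin 4 → ℂ) →ₗ[ℂ] (Fin 4 → ℂ) :=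
  LinearMap.mk₂ ℂ
    (fun x y => Pi.single k
      (if i = j then x i * y i
        else x i * y j + (-1 : ℂ) ^ ((piParity i).val * (piParity j).val) * (x j * y i)))
    (by intro x x' y; rw [← Pi.single_add]; congr 1; split_ifs <;> simp <;> ring)
    (by intro c x y; rw [← Pi.single_smul]; congr 1; split_ifs <;> simp <;> ring)
    (by intro x y y'; rw [← Pi.single_add]; congr 1; split_ifs <;> simp <;> ring)
    (by intro c x y; rw [← Pi.single_smul]; congr 1; split_ifs <;> simp <;> ring)

/-- The linear map which is multiplication by `(-1)^{|a|}` on homogeneous `a` in `L`. -/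
def signMap : (Fin 4 → ℂ) →ₗ[ℂ] (Fin 4 → ℂ) where
  toFun a := fun k => (-1 : ℂ) ^ (parity k).val * a k
  map_add' := by intro a b; ext k; simp [mul_add]
  map_smul' := by intro c a; ext k; simp; ring

/-- The bracket that corresponds to the codifferential `d`: `[a, b] = (-1)^{|a|} π d(πa · πb)`. -/
def bracketOf (d : (Fin 4 → ℂ) →ₗ[ℂ] (Fin 4 → ℂ) →ₗ[ℂ] (Fin 4 → ℂ)) :
    (Fin 4 → ℂ) →ₗ[ℂ] (Fin 4 → ℂ) →ₗ[ℂ] (Fin 4 → ℂ) :=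
  d ∘ₗ signMap

/-- The names of the algebras in the list. -/
inductive Entry : Type
  | d1 : Entry
  | d2 : Entry
  | d3 : Entry
  | d4 : Entry
  | d5 (p q : ℂ) : Entry
  | d6 (p q : ℂ) : Entry
  | d7 (p q : ℂ) : Entry
  | d8 : Entry
  | d9 : Entry
  | d10 (p q r : ℂ) : Entry
  | d11 (p q : ℂ) : Entry

/-- The codifferentials of the list. -/
def codifferential : Entry → ((Fin 4 → ℂ) →ₗ[ℂ] (Fin 4 → ℂ) →ₗ[ℂ] (Fin 4 → ℂ))
  | .d1 => psi v1 v3 v1 + psi v2 v3 v1 + (2 : ℂ) • psi v2 v3 v2 + psi v2 v4 v1 + psi v2 v4 v2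
  | .d2 => psi v1 v2 v3 + (4 : ℂ) • psi v1 v1 v3 + psi v1 v2 v4 + (2 : ℂ) • psi v2 v2 v4
  | .d3 => psi v1 v2 v3 + (4 : ℂ) • psi v1 v1 v3 + (2 : ℂ) • psi v1 v4 v2 + psi v2 v4 v2
      - psi v3 v4 v3 + psi v1 v2 v4 - psi v2 v3 v2 - psi v3 v4 v4
  | .d4 => (8 : ℂ) • psi v1 v1 v3 + psi v1 v2 v4 + (2 : ℂ) • psi v1 v1 v4
  | .d5 p q => psi v2 v3 v1 + (p - q) • psi v1 v4 v1 + p • psi v2 v4 v2 + q • psi v3 v4 v3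
  | .d6 p q => psi v1 v2 v3 + (4 : ℂ) • psi v1 v1 v3 + q • psi v1 v4 v1
      + (2 * (p - q)) • psi v1 v4 v2 + p • psi v2 v4 v2 - (p + q) • psi v3 v4 v3
  | .d7 p q => (4 : ℂ) • psi v1 v1 v3 + p • psi v1 v4 v1 + psi v1 v4 v2 + q • psi v2 v4 v2
      - (2 * p) • psi v3 v4 v3
  | .d8 => (4 : ℂ) • psi v1 v1 v3 + psi v1 v4 v1 + psi v2 v4 v2 - (2 : ℂ) • psi v3 v4 v3
  | .d9 => (4 : ℂ) • psi v1 v1 v3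
  | .d10 p q r => p • psi v1 v4 v1 + psi v2 v4 v1 + q • psi v2 v4 v2 + r • psi v3 v4 v3
  | .d11 p q => p • psi v1 v4 v1 + p • psi v2 v4 v2 + q • psi v3 v4 v3

/-- Equality of two names as points of the moduli space: the parameters of a family are
projective coordinates (the point with all coordinates zero is allowed and is a class of its
own), taken modulo the exchange of the two coordinates for `d6` and of the first two coordinates
for `d10`; moreover `d5(0:0)` and `d10(0:0:0)` name the same point. -/
inductive SamePoint : Entry → Entry → Prop
  | refl (s : Entry) : SamePoint s s
  | d5 (u p q : ℂ) (hu : u ≠ 0) : SamePoint (.d5 p q) (.d5 (u * p) (u * q))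
  | d6 (u p q : ℂ) (hu : u ≠ 0) : SamePoint (.d6 p q) (.d6 (u * p) (u * q))
  | d6_swap (u p q : ℂ) (hu : u ≠ 0) : SamePoint (.d6 p q) (.d6 (u * q) (u * p))
  | d7 (u p q : ℂ) (hu : u ≠ 0) : SamePoint (.d7 p q) (.d7 (u * p) (u * q))
  | d10 (u p q r : ℂ) (hu : u ≠ 0) : SamePoint (.d10 p q r) (.d10 (u * p) (u * q) (u * r))
  | d10_swap (u p q r : ℂ) (hu : u ≠ 0) :
      SamePoint (.d10 p q r) (.d10 (u * q) (u * p) (u * r))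
  | d11 (u p q : ℂ) (hu : u ≠ 0) : SamePoint (.d11 p q) (.d11 (u * p) (u * q))
  | d5_d10 : SamePoint (.d5 0 0) (.d10 0 0 0)
  | d10_d5 : SamePoint (.d10 0 0 0) (.d5 0 0)

theorem mem_part_zero {x : Fin 4 → ℂ} : x ∈ part 0 ↔ x 0 = 0 ∧ x 1 = 0 := by
  change (∀ k, parity k ≠ 0 → x k = 0) ↔ _
  simp [Fin.forall_fin_succ, parity]

theorem mem_part_one {x : Fin 4 → ℂ} : x ∈ part 1 ↔ x 2 = 0 ∧ x 3 = 0 := by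
  change (∀ k, parity k ≠ 1 → x k = 0) ↔ _
  simp [Fin.forall_fin_succ, parity]

theorem part_isCompl : IsCompl (part 0) (part 1) := by
  constructor
  · rw [Submodule.disjoint_def]
    intro x h0 h1
    rw [mem_part_zero] at h0
    rw [mem_part_one] at h1
    ext k
    fin_cases k <;> simp_all
  · rw [codisjoint_iff, Submodule.eq_top_iff']
    intro x
    rw [Submodule.mem_sup]
    refine ⟨![0, 0, x 2, x 3], ?_, ![x 0, x 1, 0, 0], ?_, ?_⟩
    · rw [mem_part_zero]; simp
    · rw [mem_part_one]; simp
    · ext k; fin_cases k <;> simp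

theorem psi_apply (i j k : Fin 4) (x y : Fin 4 → ℂ) : psi i j k x y = Pi.single k
      (if i = j then x i * y i
        else x i * y j + (-1 : ℂ) ^ ((piParity i).val * (piParity j).val) * (x j * y i)) := rfl

theorem zmodTwo_cases {P : ZMod 2 → Prop} (h0 : P 0) (h1 : P 1) (i : ZMod 2) : P i := by
  have h : i = 0 ∨ i = 1 := by revert i; decide
  rcases h with rfl | rfl <;> assumption

theorem val_zero' : (0 : ZMod 2).val = 0 := rfl

theorem val_one' : (1 : ZMod 2).val = 1 := rfl

theorem one_add_one' : (1 : ZMod 2) + 1 = 0 := rfl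

theorem piParity_zero : piParity 0 = 0 := rfl

theorem piParity_one : piParity 1 = 0 := rfl

theorem piParity_two : piParity 2 = 1 := rfl

theorem piParity_three : piParity 3 = 1 := rfl

theorem signMap_eq (x : Fin 4 → ℂ) : signMap x = ![-x 0, -x 1, x 2, x 3] := by
  ext k
  change (-1 : ℂ) ^ (parity k).val * x k = _
  have h0 : parity 0 = 1 := rfl
  have h1 : parity 1 = 1 := rfl
  have h2 : parity 2 = 0 := rfl
  have h3 : parity 3 = 0 := rfl
  fin_cases k <;> simp [h0, h1, h2, h3, val_one']

/-- The bracket in coordinates. -/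
def bracketFormula : Entry → (Fin 4 → ℂ) → (Fin 4 → ℂ) → (Fin 4 → ℂ)
  | .d1, x, y => ![x 2 * y 0 - x 0 * y 2 + (x 2 * y 1 - x 1 * y 2) + (x 3 * y 1 - x 1 * y 3),
      2 * (x 2 * y 1 - x 1 * y 2) + (x 3 * y 1 - x 1 * y 3), 0, 0]
  | .d2, x, y => ![0, 0, -(x 0 * y 1 + x 1 * y 0) - 4 * (x 0 * y 0),
      -(x 0 * y 1 + x 1 * y 0) - 2 * (x 1 * y 1)]
  | .d3, x, y => ![0,
      2 * (x 3 * y 0 - x 0 * y 3) + (x 3 * y 1 - x 1 * y 3) - (x 2 * y 1 - x 1 * y 2),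
      -(x 0 * y 1 + x 1 * y 0) - 4 * (x 0 * y 0) - (x 2 * y 3 - x 3 * y 2),
      -(x 0 * y 1 + x 1 * y 0) - (x 2 * y 3 - x 3 * y 2)]
  | .d4, x, y => ![0, 0, -8 * (x 0 * y 0), -(x 0 * y 1 + x 1 * y 0) - 2 * (x 0 * y 0)]
  | .d5 p q, x, y => ![(x 2 * y 1 - x 1 * y 2) + (p - q) * (x 3 * y 0 - x 0 * y 3),
      p * (x 3 * y 1 - x 1 * y 3), q * (x 2 * y 3 - x 3 * y 2), 0]
  | .d6 p q, x, y => ![q * (x 3 * y 0 - x 0 * y 3),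
      2 * (p - q) * (x 3 * y 0 - x 0 * y 3) + p * (x 3 * y 1 - x 1 * y 3),
      -(x 0 * y 1 + x 1 * y 0) - 4 * (x 0 * y 0) - (p + q) * (x 2 * y 3 - x 3 * y 2), 0]
  | .d7 p q, x, y => ![p * (x 3 * y 0 - x 0 * y 3),
      (x 3 * y 0 - x 0 * y 3) + q * (x 3 * y 1 - x 1 * y 3),
      -4 * (x 0 * y 0) - 2 * p * (x 2 * y 3 - x 3 * y 2), 0]
  | .d8, x, y => ![x 3 * y 0 - x 0 * y 3, x 3 * y 1 - x 1 * y 3,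
      -4 * (x 0 * y 0) - 2 * (x 2 * y 3 - x 3 * y 2), 0]
  | .d9, x, y => ![0, 0, -4 * (x 0 * y 0), 0]
  | .d10 p q r, x, y => ![p * (x 3 * y 0 - x 0 * y 3) + (x 3 * y 1 - x 1 * y 3),
      q * (x 3 * y 1 - x 1 * y 3), r * (x 2 * y 3 - x 3 * y 2), 0]
  | .d11 p q, x, y => ![p * (x 3 * y 0 - x 0 * y 3), p * (x 3 * y 1 - x 1 * y 3),
      q * (x 2 * y 3 - x 3 * y 2), 0]

theorem bracketOf_eq (s : Entry) (x y : Fin 4 → ℂ) :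
    bracketOf (codifferential s) x y = bracketFormula s x y := by
  cases s <;> ext k <;> fin_cases k <;>
    simp [bracketOf, bracketFormula, codifferential, v1, v2, v3, v4, psi_apply, signMap_eq,
      piParity_zero, piParity_one, piParity_two, piParity_three, val_one',
      -mul_eq_mul_left_iff, -mul_eq_mul_right_iff] <;> ring

theorem eq_of_mem_part_zero {x : Fin 4 → ℂ} (h : x ∈ part 0) :
    ∃ a b : ℂ, x = ![0, 0, a, b] := by
  rw [mem_part_zero] at h
  exact ⟨x 2, x 3, by ext k; fin_cases k <;> simp [h.1, h.2]⟩

theorem eq_of_mem_part_one {x : Fin 4 → ℂ} (h : x ∈ part 1) :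
    ∃ a b : ℂ, x = ![a, b, 0, 0] := by
  rw [mem_part_one] at h
  exact ⟨x 0, x 1, by ext k; fin_cases k <;> simp [h.1, h.2]⟩

theorem forall_mem_part {P : ZMod 2 → (Fin 4 → ℂ) → Prop}
    (h0 : ∀ a b, P 0 ![0, 0, a, b]) (h1 : ∀ a b, P 1 ![a, b, 0, 0]) :
    ∀ i, ∀ x ∈ part i, P i x := by
  refine zmodTwo_cases ?_ ?_
  · intro x hx
    obtain ⟨a, b, rfl⟩ := eq_of_mem_part_zero hx
    exact h0 a b
  · intro x hx
    obtain ⟨a, b, rfl⟩ := eq_of_mem_part_one hx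
    exact h1 a b

theorem bracketOf_mem (s : Entry) : ∀ i j : ZMod 2, ∀ x ∈ part i, ∀ y ∈ part j,
    bracketOf (codifferential s) x y ∈ part (i + j) := by
  intro i j x hx y hy
  revert j y hy
  revert i x hx
  refine forall_mem_part (fun a b => forall_mem_part ?_ ?_)
      (fun a b => forall_mem_part ?_ ?_) <;> intro c d <;>
    simp only [add_zero, zero_add, one_add_one', mem_part_zero, mem_part_one, bracketOf_eq] <;>
    cases s <;> simp [bracketFormula]

theorem bracketOf_skew (s : Entry) : ∀ i j : ZMod 2, ∀ x ∈ part i, ∀ y ∈ part j,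
    bracketOf (codifferential s) x y =
      -((-1 : ℂ) ^ (i.val * j.val) • bracketOf (codifferential s) y x) := by
  intro i j x hx y hy
  revert j y hy
  revert i x hx
  refine forall_mem_part (fun a b => forall_mem_part ?_ ?_)
      (fun a b => forall_mem_part ?_ ?_) <;> intro c d <;>
    simp only [val_zero', val_one', bracketOf_eq] <;>
    cases s <;> ext k <;> fin_cases k <;>
    simp [bracketFormula, -mul_eq_mul_left_iff, -mul_eq_mul_right_iff] <;> ring

set_option maxHeartbeats 1000000 in
theorem bracketOf_jacobi (s : Entry) : ∀ i j k : ZMod 2,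
    ∀ x ∈ part i, ∀ y ∈ part j, ∀ z ∈ part k,
    bracketOf (codifferential s) x (bracketOf (codifferential s) y z) =
      bracketOf (codifferential s) (bracketOf (codifferential s) x y) z +
      (-1 : ℂ) ^ (i.val * j.val) •
        bracketOf (codifferential s) y (bracketOf (codifferential s) x z) := by
  intro i j k x hx y hy z hz
  revert k z hz
  revert j y hy
  revert i x hx
  refine forall_mem_part
      (fun a b => forall_mem_part (fun c d => forall_mem_part ?_ ?_)
        (fun c d => forall_mem_part ?_ ?_))
      (fun a b => forall_mem_part (fun c d => forall_mem_part ?_ ?_)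
        (fun c d => forall_mem_part ?_ ?_)) <;> intro e f <;>
    simp only [val_zero', val_one', bracketOf_eq] <;>
    cases s <;> ext k <;> fin_cases k <;>
    simp [bracketFormula, -mul_eq_mul_left_iff, -mul_eq_mul_right_iff] <;> ring

/-- The Lie superalgebra with a given name. -/
def algebra (s : Entry) : LieSuperalgebra (Fin 4 → ℂ) where
  part := part
  isCompl := part_isCompl
  bracket := bracketOf (codifferential s)
  bracket_mem := bracketOf_mem s
  skew := bracketOf_skew s
  jacobi := bracketOf_jacobi s

end TwoTwo

end LieSuperalgebra

/-! Write `L₀`, `L₁` for the even and odd parts. The classification sorts algebras by the span of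
the odd brackets, that is, by the image of the symmetric map `S²L₁ → L₀` between spaces of
dimensions 3 and 2.

Rank 2: the kernel is a line spanned by a binary quadratic tensor, and over `ℂ` this is a product
`u·v` with `[u,v] = 0`. If `u, v` are independent they form an orthogonal basis, which gives `d2`;
if they are proportional there is an isotropic vector, and Jacobi leaves one parameter, whose
vanishing separates `d4` from `d3`. Rank 1: the bracket is a quadratic form on `L₁` with values in a
line. A nondegenerate form is a hyperbolic plane (`d6`); a degenerate one has a radical that the
even part preserves (`d7`, `d8`, `d9`). Rank 0: `L` is the Lie algebra `L₀` with a representation on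
`L₁`. If some element of `L₀` acts by zero and spans an ideal, only one operator remains (`d10`,
`d11`). Otherwise either `L₀` is abelian and faithful on `L₁`, so its image is spanned by the
identity and one nonscalar operator (`d1`, `d5(1:0)`), or `L₀` is nonabelian and its derived line
acts by a nonzero nilpotent (`d5`). These cases are `IsFrame.isomorphic_of_not_oddBracketOnLine`,
`IsFrame.isomorphic_of_oddBracketOnLine` and `IsFrame.isomorphic_of_odd_bracket_eq_zero`. Each
produces a basis with the brackets of a listed algebra, and `IsFrame.isomorphic` concludes.

An isomorphism between listed algebras is a pair of invertible 2×2 blocks; comparing brackets of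
basis vectors gives polynomial equations that decide which parameters match. The extension statement
is read off the list and transported along isomorphisms. -/

namespace LieSuperalgebra

/-! ### Homogeneous brackets and adapted bases -/

section

variable {L : Type*} [AddCommGroup L] [Module ℂ L]

/-- `a, b` is a basis of the odd part of `A` and `c, d` is a basis of the even part. -/
structure IsFrame (A : LieSuperalgebra L) (a b c d : L) : Prop where
  odd₁ : a ∈ A.part 1
  odd₂ : b ∈ A.part 1
  even₁ : c ∈ A.part 0
  even₂ : d ∈ A.part 0
  exists_odd : ∀ x ∈ A.part 1, ∃ s t : ℂ, x = s • a + t • b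
  exists_even : ∀ x ∈ A.part 0, ∃ s t : ℂ, x = s • c + t • d
  indep_odd : ∀ s t : ℂ, s • a + t • b = 0 → s = 0 ∧ t = 0
  indep_even : ∀ s t : ℂ, s • c + t • d = 0 → s = 0 ∧ t = 0

variable {A : LieSuperalgebra L} {a b c d x y z : L}

/-! Brackets of homogeneous elements -/

theorem bracket_mem₀₀ (hx : x ∈ A.part 0) (hy : y ∈ A.part 0) : A.bracket x y ∈ A.part 0 :=
  A.bracket_mem 0 0 x hx y hy

theorem bracket_mem₀₁ (hx : x ∈ A.part 0) (hy : y ∈ A.part 1) : A.bracket x y ∈ A.part 1 :=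
  A.bracket_mem 0 1 x hx y hy

theorem bracket_mem₁₁ (hx : x ∈ A.part 1) (hy : y ∈ A.part 1) : A.bracket x y ∈ A.part 0 :=
  A.bracket_mem 1 1 x hx y hy

theorem skew₀₀ (hx : x ∈ A.part 0) (hy : y ∈ A.part 0) : A.bracket x y = -A.bracket y x := by
  simpa using A.skew 0 0 x hx y hy

theorem skew₁₀ (hx : x ∈ A.part 1) (hy : y ∈ A.part 0) : A.bracket x y = -A.bracket y x := by
  simpa using A.skew 1 0 x hx y hy

theorem symm₁₁ (hx : x ∈ A.part 1) (hy : y ∈ A.part 1) : A.bracket x y = A.bracket y x := by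
  simpa [TwoTwo.val_one'] using A.skew 1 1 x hx y hy

theorem bracket_self₀ (hx : x ∈ A.part 0) : A.bracket x x = 0 := by
  have h := skew₀₀ hx hx
  have h2 : (2 : ℂ) • A.bracket x x = 0 := by
    rw [two_smul]; nth_rewrite 1 [h]; exact neg_add_cancel _
  simpa using h2

theorem jacobi₀ {i j : ZMod 2} (hx : x ∈ A.part 0) (hy : y ∈ A.part i) (hz : z ∈ A.part j) :
    A.bracket x (A.bracket y z) = A.bracket (A.bracket x y) z + A.bracket y (A.bracket x z) := by
  simpa using A.jacobi 0 i j x hx y hy z hz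

/-- The graded Jacobi identity for odd `x, x, y`. -/
theorem jacobi₁ (hx : x ∈ A.part 1) (hy : y ∈ A.part 1) :
    A.bracket (A.bracket x x) y = -((2 : ℂ) • A.bracket (A.bracket x y) x) := by
  have h := A.jacobi 1 1 1 x hx x hx y hy
  rw [skew₁₀ hx (bracket_mem₁₁ hx hy)] at h
  simp [TwoTwo.val_one'] at h
  linear_combination (norm := module) (-1 : ℂ) • h

/-- Jacobi for `x, x, x` reads `t = -2t`, and 3 is invertible. -/
theorem bracket_self_self (hx : x ∈ A.part 1) : A.bracket (A.bracket x x) x = 0 := by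
  have h := jacobi₁ hx hx
  have h3 : (3 : ℂ) • A.bracket (A.bracket x x) x = 0 := by
    have : (3 : ℂ) • A.bracket (A.bracket x x) x =
      A.bracket (A.bracket x x) x + (2 : ℂ) • A.bracket (A.bracket x x) x := by module
    rw [this]; nth_rewrite 1 [h]; exact neg_add_cancel _
  simpa using h3

/-! Frames -/

theorem HasBidim.exists_isFrame (h : A.HasBidim 2 2) : ∃ a b c d, A.IsFrame a b c d := by
  have key : ∀ i, Module.finrank ℂ (A.part i) = 2 → ∃ a b, a ∈ A.part i ∧ b ∈ A.part i ∧
      (∀ x ∈ A.part i, ∃ s t : ℂ, x = s • a + t • b) ∧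
      ∀ s t : ℂ, s • a + t • b = 0 → s = 0 ∧ t = 0 := by
    intro i hi
    -- `finrank` is 0 in infinite dimension, so the value 2 forces finiteness.
    have : Module.Finite ℂ (A.part i) := Module.finite_of_finrank_eq_succ hi
    let B := Module.finBasisOfFinrankEq ℂ (A.part i) hi
    refine ⟨B 0, B 1, (B 0).2, (B 1).2, fun x hx => ?_, fun s t hst => ?_⟩
    · have := B.sum_repr ⟨x, hx⟩
      rw [Fin.sum_univ_two] at this
      exact ⟨_, _, by simpa using (congrArg Subtype.val this).symm⟩
    · have := Fintype.linearIndependent_iff.1 B.linearIndependent ![s, t] (by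
        rw [Fin.sum_univ_two]; ext; simpa using hst)
      exact ⟨this 0, this 1⟩
  obtain ⟨a, b, h1, h2, h3, h4⟩ := key 1 h.2
  obtain ⟨c, d, h5, h6, h7, h8⟩ := key 0 h.1
  exact ⟨a, b, c, d, h1, h2, h5, h6, h3, h7, h4, h8⟩

/-- Cramer's rule. -/
theorem exists_of_det_ne_zero {p q r s : ℂ} (hdet : p * s - q * r ≠ 0) {a b : L} (m n : ℂ) :
    ∃ t u : ℂ, m • a + n • b = t • (p • a + q • b) + u • (r • a + s • b) := by
  refine ⟨(m * s - n * r) / (p * s - q * r), (n * p - m * q) / (p * s - q * r), ?_⟩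
  match_scalars
  · rw [mul_one, mul_one, mul_one]
    linear_combination (-m) * (mul_inv_cancel₀ hdet)
  · rw [mul_one, mul_one, mul_one]
    linear_combination (-n) * (mul_inv_cancel₀ hdet)

theorem indep_of_det_ne_zero {p q r s : ℂ} (hdet : p * s - q * r ≠ 0) {a b : L}
    (h : ∀ s t : ℂ, s • a + t • b = 0 → s = 0 ∧ t = 0) (t u : ℂ)
    (h0 : t • (p • a + q • b) + u • (r • a + s • b) = 0) : t = 0 ∧ u = 0 := by
  obtain ⟨h1, h2⟩ := h (t * p + u * r) (t * q + u * s) (by rw [← h0]; module)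
  constructor
  · have : t * (p * s - q * r) = 0 := by linear_combination s * h1 - r * h2
    simpa [hdet] using this
  · have : u * (p * s - q * r) = 0 := by linear_combination p * h2 - q * h1
    simpa [hdet] using this

theorem IsFrame.change_odd (h : A.IsFrame a b c d) {p q r s : ℂ} (hdet : p * s - q * r ≠ 0) :
    A.IsFrame (p • a + q • b) (r • a + s • b) c d where
  odd₁ := add_mem (Submodule.smul_mem _ _ h.odd₁) (Submodule.smul_mem _ _ h.odd₂)
  odd₂ := add_mem (Submodule.smul_mem _ _ h.odd₁) (Submodule.smul_mem _ _ h.odd₂)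
  even₁ := h.even₁
  even₂ := h.even₂
  exists_odd := by
    intro x hx
    obtain ⟨m, n, rfl⟩ := h.exists_odd x hx
    exact exists_of_det_ne_zero hdet m n
  exists_even := h.exists_even
  indep_odd := indep_of_det_ne_zero hdet h.indep_odd
  indep_even := h.indep_even

theorem IsFrame.change_even (h : A.IsFrame a b c d) {p q r s : ℂ} (hdet : p * s - q * r ≠ 0) :
    A.IsFrame a b (p • c + q • d) (r • c + s • d) where
  odd₁ := h.odd₁
  odd₂ := h.odd₂
  even₁ := add_mem (Submodule.smul_mem _ _ h.even₁) (Submodule.smul_mem _ _ h.even₂)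
  even₂ := add_mem (Submodule.smul_mem _ _ h.even₁) (Submodule.smul_mem _ _ h.even₂)
  exists_odd := h.exists_odd
  exists_even := by
    intro x hx
    obtain ⟨m, n, rfl⟩ := h.exists_even x hx
    exact exists_of_det_ne_zero hdet m n
  indep_odd := h.indep_odd
  indep_even := indep_of_det_ne_zero hdet h.indep_even

/-- A nonzero odd vector is the second vector of a frame. -/
theorem IsFrame.exists_odd₂ (h : A.IsFrame a b c d) (hx : x ∈ A.part 1) (hx0 : x ≠ 0) :
    ∃ a', A.IsFrame a' x c d := by
  obtain ⟨p, q, rfl⟩ := h.exists_odd x hx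
  by_cases hp : p = 0
  · have hq : q ≠ 0 := by rintro rfl; simp [hp] at hx0
    exact ⟨_, h.change_odd (p := 1) (q := 0) (by simpa using hq)⟩
  · exact ⟨_, h.change_odd (p := 0) (q := 1) (by simpa using hp)⟩

theorem IsFrame.swap_odd (h : A.IsFrame a b c d) : A.IsFrame b a c d := by
  simpa using h.change_odd (p := 0) (q := 1) (r := 1) (s := 0) (by simp)

theorem IsFrame.swap_even (h : A.IsFrame a b c d) : A.IsFrame a b d c := by
  simpa using h.change_even (p := 0) (q := 1) (r := 1) (s := 0) (by simp)

/-- A nonzero even vector is the third vector of a frame. -/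
theorem IsFrame.exists_even₁ (h : A.IsFrame a b c d) (hx : x ∈ A.part 0) (hx0 : x ≠ 0) :
    ∃ d', A.IsFrame a b x d' := by
  obtain ⟨p, q, rfl⟩ := h.exists_even x hx
  by_cases hp : p = 0
  · have hq : q ≠ 0 := by rintro rfl; simp [hp] at hx0
    exact ⟨_, h.change_even (r := 1) (s := 0) (by simpa using hq)⟩
  · exact ⟨_, h.change_even (r := 0) (s := 1) (by simpa using hp)⟩

theorem IsFrame.ne_zero_odd (h : A.IsFrame a b c d) {p q : ℂ} (hpq : p ≠ 0 ∨ q ≠ 0) :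
    p • a + q • b ≠ 0 := fun h0 => by
  obtain ⟨rfl, rfl⟩ := h.indep_odd p q h0
  simp at hpq

theorem IsFrame.even₁_ne_zero (h : A.IsFrame a b c d) : c ≠ 0 := fun h0 => by
  simpa using (h.indep_even 1 0 (by simp [h0])).1

/-- The linear combination of four vectors with given coefficients. -/
def combination (a b c d : L) (x : Fin 4 → ℂ) : L := x 0 • a + x 1 • b + x 2 • c + x 3 • d

/-- An algebra with a frame whose brackets are those of the standard basis of `TwoTwo.algebra s`
is isomorphic to `TwoTwo.algebra s`. -/
theorem IsFrame.isomorphic (h : A.IsFrame a b c d) (s : TwoTwo.Entry)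
    (haa : A.bracket a a = combination a b c d
      (TwoTwo.bracketFormula s ![1, 0, 0, 0] ![1, 0, 0, 0]))
    (hab : A.bracket a b = combination a b c d
      (TwoTwo.bracketFormula s ![1, 0, 0, 0] ![0, 1, 0, 0]))
    (hbb : A.bracket b b = combination a b c d
      (TwoTwo.bracketFormula s ![0, 1, 0, 0] ![0, 1, 0, 0]))
    (hca : A.bracket c a = combination a b c d
      (TwoTwo.bracketFormula s ![0, 0, 1, 0] ![1, 0, 0, 0]))
    (hcb : A.bracket c b = combination a b c d
      (TwoTwo.bracketFormula s ![0, 0, 1, 0] ![0, 1, 0, 0]))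
    (hda : A.bracket d a = combination a b c d
      (TwoTwo.bracketFormula s ![0, 0, 0, 1] ![1, 0, 0, 0]))
    (hdb : A.bracket d b = combination a b c d
      (TwoTwo.bracketFormula s ![0, 0, 0, 1] ![0, 1, 0, 0]))
    (hcd : A.bracket c d = combination a b c d
      (TwoTwo.bracketFormula s ![0, 0, 1, 0] ![0, 0, 0, 1])) :
    A.Isomorphic (TwoTwo.algebra s) := by
  let f : (Fin 4 → ℂ) →ₗ[ℂ] L :=
    { toFun := fun x => x 0 • a + x 1 • b + x 2 • c + x 3 • d
      map_add' := by intro x y; simp only [Pi.add_apply]; module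
      map_smul' := by intro r x; simp only [Pi.smul_apply, smul_eq_mul, RingHom.id_apply]; module }
  have hf : ∀ x, f x = x 0 • a + x 1 • b + x 2 • c + x 3 • d := fun _ => rfl
  have hodd : ∀ s t : ℂ, s • a + t • b ∈ A.part 1 := fun s t =>
    add_mem (Submodule.smul_mem _ _ h.odd₁) (Submodule.smul_mem _ _ h.odd₂)
  have heven : ∀ s t : ℂ, s • c + t • d ∈ A.part 0 := fun s t =>
    add_mem (Submodule.smul_mem _ _ h.even₁) (Submodule.smul_mem _ _ h.even₂)
  have hinj : Function.Injective f := by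
    rw [← LinearMap.ker_eq_bot, LinearMap.ker_eq_bot']
    intro x hx
    rw [hf] at hx
    -- This vector is odd and equals an even one, so it vanishes.
    have h1 : x 0 • a + x 1 • b = -(x 2 • c + x 3 • d) := by
      rw [eq_neg_iff_add_eq_zero, ← hx]; abel
    have h2 : x 0 • a + x 1 • b = 0 :=
      (Submodule.disjoint_def.1 A.isCompl.disjoint) _ (h1 ▸ neg_mem (heven _ _)) (hodd _ _)
    have h3 : x 2 • c + x 3 • d = 0 := by
      rw [h2] at h1; exact neg_eq_zero.1 h1.symm
    have h4 := h.indep_odd _ _ h2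
    have h5 := h.indep_even _ _ h3
    ext k; fin_cases k
    exacts [h4.1, h4.2, h5.1, h5.2]
  have hsurj : Function.Surjective f := by
    intro x
    have hx : x ∈ A.part 0 ⊔ A.part 1 := by rw [A.isCompl.sup_eq_top]; trivial
    obtain ⟨y, hy, z, hz, rfl⟩ := Submodule.mem_sup.1 hx
    obtain ⟨s, t, rfl⟩ := h.exists_even y hy
    obtain ⟨s', t', rfl⟩ := h.exists_odd z hz
    exact ⟨![s', t', s, t], by rw [hf]; simp; abel⟩
  let E := LinearEquiv.ofBijective f ⟨hinj, hsurj⟩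
  have hE : ∀ x, E x = f x := fun _ => rfl
  refine ⟨E.symm, ?_, ?_⟩
  · intro i
    refine TwoTwo.zmodTwo_cases
      (P := fun i => ∀ x ∈ A.part i, E.symm x ∈ (TwoTwo.algebra s).part i) ?_ ?_ i
    · intro x hx
      obtain ⟨s, t, rfl⟩ := h.exists_even x hx
      have : E.symm (s • c + t • d) = ![0, 0, s, t] := by
        rw [LinearEquiv.symm_apply_eq, hE, hf]; simp
      rw [this]
      exact TwoTwo.mem_part_zero.2 (by simp)
    · intro x hx
      obtain ⟨s, t, rfl⟩ := h.exists_odd x hx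
      have : E.symm (s • a + t • b) = ![s, t, 0, 0] := by
        rw [LinearEquiv.symm_apply_eq, hE, hf]; simp
      rw [this]
      exact TwoTwo.mem_part_one.2 (by simp)
  · intro x y
    obtain ⟨x, rfl⟩ := E.surjective x
    obtain ⟨y, rfl⟩ := E.surjective y
    rw [LinearEquiv.symm_apply_eq, E.symm_apply_apply, E.symm_apply_apply]
    change _ = f (TwoTwo.bracketOf (TwoTwo.codifferential s) x y)
    -- Graded skew-symmetry recovers the other basis brackets from the eight given ones.
    have hba := symm₁₁ h.odd₂ h.odd₁
    have hac := skew₁₀ h.odd₁ h.even₁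
    have hbc := skew₁₀ h.odd₂ h.even₁
    have had := skew₁₀ h.odd₁ h.even₂
    have hbd := skew₁₀ h.odd₂ h.even₂
    have hdc := skew₀₀ h.even₂ h.even₁
    have hcc := bracket_self₀ h.even₁
    have hdd := bracket_self₀ h.even₂
    rw [TwoTwo.bracketOf_eq, hE, hE, hf, hf, hf]
    simp only [combination] at haa hab hbb hca hcb hda hdb hcd
    simp only [map_add, map_smul, LinearMap.add_apply, LinearMap.smul_apply, hba, hac, hbc, had,
      hbd, hdc, hcc, hdd, haa, hab, hbb, hca, hcb, hda, hdb, hcd]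
    cases s <;> simp [TwoTwo.bracketFormula] <;> module

end

end LieSuperalgebra

/-! ### Completeness: normal forms according to the span of the odd brackets -/

namespace LieSuperalgebra

section

variable {L : Type*} [AddCommGroup L] [Module ℂ L]
variable {A : LieSuperalgebra L} {a b c d x y z : L}

/-- A binary quadratic form over `ℂ` is a product of linear forms. -/
theorem exists_factorization (α β γ : ℂ) :
    ∃ r s r' s' : ℂ, α = r * r' ∧ β = r * s' + s * r' ∧ γ = s * s' := by
  by_cases hα : α = 0
  · exact ⟨0, 1, β, γ, by simp [hα], by ring, by ring⟩
  · obtain ⟨w, hw⟩ := IsAlgClosed.exists_pow_nat_eq (β ^ 2 - 4 * α * γ) two_pos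
    refine ⟨α, (β - w) / 2, 1, (β + w) / (2 * α), by ring, ?_, ?_⟩
    · field_simp; ring
    · field_simp; linear_combination hw

/-- Two even vectors form a basis of the even part or lie on a line. -/
theorem IsFrame.even_dichotomy (h : A.IsFrame a b c d) (hx : x ∈ A.part 0) (hy : y ∈ A.part 0) :
    A.IsFrame a b x y ∨ ∃ e ∈ A.part 0, ∃ k l : ℂ, x = k • e ∧ y = l • e := by
  obtain ⟨p, q, rfl⟩ := h.exists_even x hx
  obtain ⟨r, s, rfl⟩ := h.exists_even y hy
  by_cases hdet : p * s - q * r = 0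
  · right
    by_cases hp : p = 0
    · by_cases hq : q = 0
      · exact ⟨_, hy, 0, 1, by simp [hp, hq], by simp⟩
      · refine ⟨_, hx, 1, s / q, by simp, ?_⟩
        have hr : r = 0 := by simpa [hp, hq] using hdet
        match_scalars <;> simp [hp, hr, hq]
    · refine ⟨_, hx, 1, r / p, by simp, ?_⟩
      match_scalars
      · field_simp
      · field_simp; linear_combination hdet
  · exact Or.inl (h.change_even hdet)

/-! Algebras whose odd brackets span the even part -/

/-- With an orthogonal odd basis Jacobi makes all of `L₀` central, so only the odd bracket has to be
matched. -/
theorem IsFrame.isomorphic_d2 (h : A.IsFrame a b c d) (haa : A.bracket a a = c)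
    (hab : A.bracket a b = 0) (hbb : A.bracket b b = d) :
    A.Isomorphic (TwoTwo.algebra .d2) := by
  have hba : A.bracket b a = 0 := by rw [symm₁₁ h.odd₂ h.odd₁, hab]
  have hca : A.bracket c a = 0 := by rw [← haa]; exact bracket_self_self h.odd₁
  have hdb : A.bracket d b = 0 := by rw [← hbb]; exact bracket_self_self h.odd₂
  have hcb : A.bracket c b = 0 := by rw [← haa, jacobi₁ h.odd₁ h.odd₂, hab]; simp
  have hda : A.bracket d a = 0 := by rw [← hbb, jacobi₁ h.odd₂ h.odd₁, hba]; simp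
  have hcd : A.bracket c d = 0 := by
    rw [← hbb, jacobi₀ h.even₁ h.odd₂ h.odd₂, hcb]; simp
  have hcc := bracket_self₀ h.even₁
  have hdd := bracket_self₀ h.even₂
  have hdc : A.bracket d c = 0 := by rw [skew₀₀ h.even₂ h.even₁, hcd, neg_zero]
  -- In `d2` one has `[v1,v2] = ¼[v1,v1] + ½[v2,v2]`; the quadratic form of this relation has
  -- discriminant 1/2, so its linear factors need `w = √2`. The new even vectors are then
  -- `-¼[v1,v1]` and `-½[v2,v2]`.
  obtain ⟨w, hw⟩ := IsAlgClosed.exists_pow_nat_eq (2 : ℂ) two_pos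
  have hw0 : w ≠ 0 := by rintro rfl; simp at hw
  refine ((h.change_odd (p := w - 2) (q := w + 2) (r := -1) (s := 1) ?_).change_even
    (p := -(6 - 4 * w) / 4) (q := -(6 + 4 * w) / 4) (r := -1 / 2) (s := -1 / 2) ?_).isomorphic
    .d2 ?_ ?_ ?_ ?_ ?_ ?_ ?_ ?_
  · intro h0; apply hw0; linear_combination h0 / 2
  · intro h0; apply hw0; linear_combination -h0
  all_goals simp only [map_add, map_smul, LinearMap.add_apply, LinearMap.smul_apply, haa, hab, hba,
    hbb, hca, hcb, hda, hdb, hcd, hdc, hcc, hdd, combination, TwoTwo.bracketFormula]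
  all_goals simp
  · match_scalars
    · linear_combination hw
    · linear_combination hw
  · module
  · module

/-- Jacobi determines everything from one number `y`, where `[d,a] = y b`: zero gives `d4`, and any
nonzero value can be rescaled to that of `d3`. -/
theorem IsFrame.isomorphic_d3_or_d4 (h : A.IsFrame a b c d) (haa : A.bracket a a = c)
    (hab : A.bracket a b = d) (hbb : A.bracket b b = 0) :
    A.Isomorphic (TwoTwo.algebra .d3) ∨ A.Isomorphic (TwoTwo.algebra .d4) := by
  have hba : A.bracket b a = d := by rw [symm₁₁ h.odd₂ h.odd₁, hab]
  have hca : A.bracket c a = 0 := by rw [← haa]; exact bracket_self_self h.odd₁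
  have hdb : A.bracket d b = 0 := by
    have := jacobi₁ h.odd₂ h.odd₁
    rw [hbb, hba] at this
    simpa using this
  have hcb : A.bracket c b = -((2 : ℂ) • A.bracket d a) := by
    rw [← haa, jacobi₁ h.odd₁ h.odd₂, hab]
  obtain ⟨m, y, hda⟩ := h.exists_odd _ (bracket_mem₀₁ h.even₂ h.odd₁)
  have hm : m = 0 := by
    have h1 := jacobi₀ h.even₂ h.odd₁ h.odd₂
    rw [hab, hda, hdb, bracket_self₀ h.even₂] at h1
    simpa [hab, hbb, h.swap_even.even₁_ne_zero] using h1.symm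
  subst hm
  rw [zero_smul, zero_add] at hda
  rw [hda] at hcb
  have hcd : A.bracket c d = -((2 * y) • d) := by
    rw [← hab, jacobi₀ h.even₁ h.odd₁ h.odd₂, hca, hcb]
    simp [hab]
    module
  have hcc := bracket_self₀ h.even₁
  have hdd := bracket_self₀ h.even₂
  have hdc : A.bracket d c = (2 * y) • d := by rw [skew₀₀ h.even₂ h.even₁, hcd, neg_neg]
  by_cases hy : y = 0
  · right
    subst hy
    refine (h.change_even (p := -1 / 8) (q := 1 / 4) (r := 0) (s := -1) (by norm_num)).isomorphic
      .d4 ?_ ?_ ?_ ?_ ?_ ?_ ?_ ?_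
    all_goals simp only [map_add, map_smul, LinearMap.add_apply, LinearMap.smul_apply, haa, hab,
      hbb, hca, hcb, hda, hdb, hcd, hdc, hcc, hdd, combination, TwoTwo.bracketFormula]
    all_goals simp
    module
  · left
    -- With `v1 = w a` and `v4 = (w²/4) c - w d`, the condition `[v4,v1] = 2 v2` becomes `w² y =
    -- -2`.
    obtain ⟨w, hw⟩ := IsAlgClosed.exists_pow_nat_eq (-2 / y) two_pos
    have hw' : w ^ 2 * y = -2 := by rw [hw]; field_simp
    have hw0 : w ≠ 0 := by rintro rfl; simp at hw'
    refine ((h.change_odd (p := w) (q := 0) (r := 0) (s := 1) ?_).change_even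
      (p := -w ^ 2 / 4) (q := 0) (r := w ^ 2 / 4) (s := -w) ?_).isomorphic .d3 ?_ ?_ ?_ ?_ ?_ ?_ ?_ ?_
    · simpa using hw0
    · intro h0; apply hw0; simpa using h0
    all_goals simp only [map_add, map_smul, LinearMap.add_apply, LinearMap.smul_apply, haa, hab,
      hba, hbb, hca, hcb, hda, hdb, hcd, hdc, hcc, hdd, combination, TwoTwo.bracketFormula]
    all_goals simp
    · module
    · module
    · match_scalars; linear_combination -hw' / 2
    · match_scalars; linear_combination -hw'
    · match_scalars; linear_combination -hw' / 2
    · match_scalars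
      · linear_combination (-w / 2) * hw'
      · ring

/-- All brackets of odd elements are multiples of one even vector. -/
def OddBracketOnLine (A : LieSuperalgebra L) : Prop :=
  ∃ e ∈ A.part 0, ∀ x ∈ A.part 1, ∀ y ∈ A.part 1, ∃ k : ℂ, A.bracket x y = k • e

theorem IsFrame.oddBracketOnLine (h : A.IsFrame a b c d) (hx : x ∈ A.part 0) {k l m : ℂ}
    (haa : A.bracket a a = k • x) (hab : A.bracket a b = l • x) (hbb : A.bracket b b = m • x) :
    A.OddBracketOnLine := by
  have hba := symm₁₁ h.odd₂ h.odd₁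
  refine ⟨x, hx, fun y hy z hz => ?_⟩
  obtain ⟨p, q, rfl⟩ := h.exists_odd y hy
  obtain ⟨r, s, rfl⟩ := h.exists_odd z hz
  refine ⟨p * r * k + p * s * l + q * r * l + q * s * m, ?_⟩
  simp only [map_add, map_smul, LinearMap.add_apply, LinearMap.smul_apply, haa, hba, hab, hbb]
  module

/-- Two linear equations in three unknowns. This supplies a linear relation among `[a,a]`, `[a,b]`,
`[b,b]` in the plane `L₀`. -/
theorem exists_orthogonal (s t : Fin 3 → ℂ) : ∃ r : Fin 3 → ℂ, r ≠ 0 ∧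
    r 0 * s 0 + r 1 * s 1 + r 2 * s 2 = 0 ∧ r 0 * t 0 + r 1 * t 1 + r 2 * t 2 = 0 := by
  have h := LinearMap.ker_ne_bot_of_finrank_lt (f := (!![s 0, s 1, s 2; t 0, t 1, t 2]).mulVecLin)
    (by simp)
  obtain ⟨r, hr, hr0⟩ := Submodule.exists_mem_ne_zero_of_ne_bot h
  refine ⟨r, hr0, ?_, ?_⟩
  · have := congrFun (LinearMap.mem_ker.1 hr) 0
    simp [Matrix.mulVec, dotProduct, Fin.sum_univ_three] at this
    linear_combination this
  · have := congrFun (LinearMap.mem_ker.1 hr) 1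
    simp [Matrix.mulVec, dotProduct, Fin.sum_univ_three] at this
    linear_combination this

/-- A relation among the odd brackets factors as `[u,v] = 0` with `u = r a + s b` and `v = r' a + s'
b`. Proportional `u, v` give an isotropic vector, independent ones an orthogonal basis; since the
brackets do not lie on a line, the other two brackets form a basis of `L₀`. -/
theorem IsFrame.isomorphic_of_not_oddBracketOnLine (h : A.IsFrame a b c d)
    (hA : ¬ A.OddBracketOnLine) : ∃ s, A.Isomorphic (TwoTwo.algebra s) := by
  obtain ⟨s₁, t₁, h1⟩ := h.exists_even _ (bracket_mem₁₁ h.odd₁ h.odd₁)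
  obtain ⟨s₂, t₂, h2⟩ := h.exists_even _ (bracket_mem₁₁ h.odd₁ h.odd₂)
  obtain ⟨s₃, t₃, h3⟩ := h.exists_even _ (bracket_mem₁₁ h.odd₂ h.odd₂)
  obtain ⟨f, hf, hfs, hft⟩ := exists_orthogonal ![s₁, s₂, s₃] ![t₁, t₂, t₃]
  obtain ⟨r, s, r', s', e1, e2, e3⟩ := exists_factorization (f 0) (f 1) (f 2)
  have hba := symm₁₁ h.odd₂ h.odd₁
  have hrel : (r * r') • A.bracket a a + (r * s' + s * r') • A.bracket a b +
      (s * s') • A.bracket b b = 0 := by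
    simp at hfs hft
    rw [h1, h2, h3, ← e1, ← e2, ← e3]
    match_scalars
    · linear_combination hfs
    · linear_combination hft
  have hrs : r ≠ 0 ∨ s ≠ 0 := by
    by_contra! h0
    apply hf
    ext k; fin_cases k <;> simp [e1, e2, e3, h0]
  have hrs' : r' ≠ 0 ∨ s' ≠ 0 := by
    by_contra! h0
    apply hf
    ext k; fin_cases k <;> simp [e1, e2, e3, h0]
  by_cases hdet : r * s' - s * r' = 0
  · obtain ⟨k, hr', hs'⟩ : ∃ k, r' = k * r ∧ s' = k * s := by
      by_cases hr : r = 0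
      · have hs : s ≠ 0 := hrs.resolve_left (by simp [hr])
        refine ⟨s' / s, ?_, by field_simp⟩
        simpa [hr, hs] using hdet
      · refine ⟨r' / r, by field_simp, ?_⟩
        field_simp; linear_combination hdet
    have hk : k ≠ 0 := by
      rintro rfl
      simp [hr', hs'] at hrs'
    have hu : r • a + s • b ∈ A.part 1 :=
      add_mem (Submodule.smul_mem _ _ h.odd₁) (Submodule.smul_mem _ _ h.odd₂)
    obtain ⟨a', h'⟩ := h.exists_odd₂ hu (h.ne_zero_odd hrs)
    have hbb : A.bracket (r • a + s • b) (r • a + s • b) = 0 := by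
      have : k • A.bracket (r • a + s • b) (r • a + s • b) = 0 := by
        rw [← hrel, hr', hs']
        simp only [map_add, map_smul, LinearMap.add_apply, LinearMap.smul_apply, hba]
        module
      exact (smul_eq_zero.1 this).resolve_left hk
    rcases h'.even_dichotomy (bracket_mem₁₁ h'.odd₁ h'.odd₁) (bracket_mem₁₁ h'.odd₁ h'.odd₂) with
      h'' | ⟨e, he, l, m, h4, h5⟩
    · rcases h''.isomorphic_d3_or_d4 rfl rfl hbb with h6 | h6
      exacts [⟨_, h6⟩, ⟨_, h6⟩]
    · exact absurd (h'.oddBracketOnLine he h4 h5 (m := 0) (by rw [hbb, zero_smul])) hA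
  · have h' := h.change_odd hdet
    have hab : A.bracket (r • a + s • b) (r' • a + s' • b) = 0 := by
      rw [← hrel]
      simp only [map_add, map_smul, LinearMap.add_apply, LinearMap.smul_apply, hba]
      module
    rcases h'.even_dichotomy (bracket_mem₁₁ h'.odd₁ h'.odd₁) (bracket_mem₁₁ h'.odd₂ h'.odd₂) with
      h'' | ⟨e, he, l, m, h4, h5⟩
    · exact ⟨_, h''.isomorphic_d2 rfl hab rfl⟩
    · exact absurd (h'.oddBracketOnLine he h4 (l := 0) (by rw [hab, zero_smul]) h5) hA

/-! Algebras whose odd brackets span a line -/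

/-- The hyperbolic plane: `d` acts by derivations, so it preserves both isotropic lines and is
diagonal, while `c` acts by zero. -/
theorem IsFrame.isomorphic_d6 (h : A.IsFrame a b c d) (haa : A.bracket a a = 0)
    (hab : A.bracket a b = c) (hbb : A.bracket b b = 0) :
    ∃ s, A.Isomorphic (TwoTwo.algebra s) := by
  have hc0 := h.even₁_ne_zero
  have hba : A.bracket b a = c := by rw [symm₁₁ h.odd₂ h.odd₁, hab]
  have hca : A.bracket c a = 0 := by
    have := jacobi₁ h.odd₁ h.odd₂
    rw [haa, hab] at this
    simpa using this
  have hcb : A.bracket c b = 0 := by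
    have := jacobi₁ h.odd₂ h.odd₁
    rw [hbb, hba] at this
    simpa using this
  obtain ⟨q, m, hda⟩ := h.exists_odd _ (bracket_mem₀₁ h.even₂ h.odd₁)
  obtain ⟨n, p, hdb⟩ := h.exists_odd _ (bracket_mem₀₁ h.even₂ h.odd₂)
  have hm : m = 0 := by
    have := jacobi₀ h.even₂ h.odd₁ h.odd₁
    rw [hda, haa] at this
    simpa [haa, hab, hba, hc0, ← add_smul] using this.symm
  have hn : n = 0 := by
    have := jacobi₀ h.even₂ h.odd₂ h.odd₂
    rw [hdb, hbb] at this
    simpa [hbb, hab, hba, hc0, ← add_smul] using this.symm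
  subst hm hn
  simp only [zero_smul, add_zero, zero_add] at hda hdb
  have hdc : A.bracket d c = (p + q) • c := by
    rw [← hab, jacobi₀ h.even₂ h.odd₁ h.odd₂, hda, hdb]
    simp [hab]
    module
  have hcd : A.bracket c d = -((p + q) • c) := by rw [skew₀₀ h.even₁ h.even₂, hdc]
  refine ⟨.d6 p q, ((h.change_odd (p := 1) (q := 2) (r := 0) (s := 1) (by simp)).change_even
    (p := -1) (q := 0) (r := 0) (s := 1) (by simp)).isomorphic _ ?_ ?_ ?_ ?_ ?_ ?_ ?_ ?_⟩
  all_goals simp only [map_add, map_smul, LinearMap.add_apply, LinearMap.smul_apply, haa, hab,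
    hba, hbb, hca, hcb, hda, hdb, hcd, combination, TwoTwo.bracketFormula]
  all_goals simp
  all_goals module

/-- The form of rank one: `d` preserves the radical spanned by `b`, so its action on the odd part is
triangular. -/
theorem IsFrame.isomorphic_d7_d8_d9 (h : A.IsFrame a b c d) (haa : A.bracket a a = c)
    (hab : A.bracket a b = 0) (hbb : A.bracket b b = 0) :
    ∃ s, A.Isomorphic (TwoTwo.algebra s) := by
  have hc0 := h.even₁_ne_zero
  have hba : A.bracket b a = 0 := by rw [symm₁₁ h.odd₂ h.odd₁, hab]
  have hca : A.bracket c a = 0 := by rw [← haa]; exact bracket_self_self h.odd₁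
  have hcb : A.bracket c b = 0 := by rw [← haa, jacobi₁ h.odd₁ h.odd₂, hab]; simp
  obtain ⟨p, y, hda⟩ := h.exists_odd _ (bracket_mem₀₁ h.even₂ h.odd₁)
  obtain ⟨n, q, hdb⟩ := h.exists_odd _ (bracket_mem₀₁ h.even₂ h.odd₂)
  have hn : n = 0 := by
    have := jacobi₀ h.even₂ h.odd₁ h.odd₂
    rw [hda, hdb, hab] at this
    simpa [haa, hbb, hab, hba, hc0, eq_comm (a := (0 : L))] using this
  subst hn
  simp only [zero_smul, zero_add] at hdb
  have hdc : A.bracket d c = (2 * p) • c := by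
    rw [← haa, jacobi₀ h.even₂ h.odd₁ h.odd₁, hda]
    simp [haa, hab, hba]
    module
  have hcd : A.bracket c d = -((2 * p) • c) := by rw [skew₀₀ h.even₁ h.even₂, hdc]
  -- Replacing `a` by `a + t b` changes the off-diagonal entry `y` to `y + t(q - p)`. It can be made
  -- nonzero, which gives `d7`, unless `d` acts as a scalar.
  have h7 : ∀ t u : ℂ, u ≠ 0 → y + t * (q - p) = u → A.Isomorphic (TwoTwo.algebra (.d7 p q)) := by
    intro t u hu ht
    refine ((h.change_odd (p := 1) (q := t) (r := 0) (s := u) (by simpa using hu)).change_even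
      (p := -1 / 4) (q := 0) (r := 0) (s := 1) (by simp)).isomorphic _ ?_ ?_ ?_ ?_ ?_ ?_ ?_ ?_
    all_goals simp only [map_add, map_smul, LinearMap.add_apply, LinearMap.smul_apply, haa, hab,
      hba, hbb, hca, hcb, hda, hdb, hcd, combination, TwoTwo.bracketFormula]
    all_goals simp
    · module
    · match_scalars
      · ring
      · linear_combination ht
    · module
    · module
  by_cases hy : y = 0
  · by_cases hpq : p = q
    · subst hpq hy
      rw [zero_smul, add_zero] at hda
      by_cases hp : p = 0
      · subst hp
        refine ⟨.d9, (h.change_even (p := -1 / 4) (q := 0) (r := 0) (s := 1) (by simp)).isomorphic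
          _ ?_ ?_ ?_ ?_ ?_ ?_ ?_ ?_⟩
        all_goals simp only [map_add, map_smul, LinearMap.add_apply, LinearMap.smul_apply, haa, hab,
          hbb, hca, hcb, hda, hdb, hcd, combination, TwoTwo.bracketFormula]
        all_goals simp
        all_goals module
      · refine ⟨.d8, (h.change_even (p := -1 / 4) (q := 0) (r := 0) (s := p⁻¹)
          (by simpa using hp)).isomorphic _ ?_ ?_ ?_ ?_ ?_ ?_ ?_ ?_⟩
        all_goals simp only [map_add, map_smul, LinearMap.add_apply, LinearMap.smul_apply, haa, hab,
          hbb, hca, hcb, hda, hdb, hcd, combination, TwoTwo.bracketFormula]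
        all_goals simp [smul_smul, hp]
        all_goals match_scalars; field_simp
    · refine ⟨_, h7 ((q - p)⁻¹) 1 one_ne_zero ?_⟩
      have : q - p ≠ 0 := sub_ne_zero.2 (Ne.symm hpq)
      rw [hy, zero_add, inv_mul_cancel₀ this]
  · exact ⟨_, h7 0 y hy (by ring)⟩

/-- A binary quadratic form over `ℂ` has an isotropic vector, which is taken as `b`. The form is
then degenerate or hyperbolic according to whether `[a,b]` vanishes. -/
theorem IsFrame.isomorphic_of_oddBracketOnLine (h : A.IsFrame a b c d)
    (hA : A.OddBracketOnLine) (h0 : ¬ ∀ x ∈ A.part 1, ∀ y ∈ A.part 1, A.bracket x y = 0) :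
    ∃ s, A.Isomorphic (TwoTwo.algebra s) := by
  obtain ⟨e, he, hA⟩ := hA
  have he0 : e ≠ 0 := by
    rintro rfl
    refine h0 fun x hx y hy => ?_
    obtain ⟨k, hk⟩ := hA x hx y hy
    simpa using hk
  obtain ⟨d, h⟩ := h.exists_even₁ he he0
  have h0' : ∀ {a b c d : L}, A.IsFrame a b c d → A.bracket a a = 0 → A.bracket a b = 0 →
      A.bracket b b = 0 → False := by
    intro a b c d h h1 h2 h3
    have hba : A.bracket b a = 0 := by rw [symm₁₁ h.odd₂ h.odd₁, h2]
    refine h0 fun x hx y hy => ?_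
    obtain ⟨p, q, rfl⟩ := h.exists_odd x hx
    obtain ⟨r, s, rfl⟩ := h.exists_odd y hy
    simp [h1, h2, h3, hba]
  obtain ⟨α, hα⟩ := hA a h.odd₁ a h.odd₁
  obtain ⟨β, hβ⟩ := hA a h.odd₁ b h.odd₂
  obtain ⟨γ, hγ⟩ := hA b h.odd₂ b h.odd₂
  have hba := symm₁₁ h.odd₂ h.odd₁
  obtain ⟨r, s, r', s', e1, e2, e3⟩ := exists_factorization α (2 * β) γ
  have hrs : s ≠ 0 ∨ -r ≠ 0 := by
    by_contra! hrs
    have hr : r = 0 := by simpa using hrs.2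
    rw [hr, zero_mul] at e1
    rw [hr, hrs.1, zero_mul, zero_mul, zero_add] at e2
    rw [hrs.1, zero_mul] at e3
    refine h0' h (by simp [hα, e1]) ?_ (by simp [hγ, e3])
    have : β = 0 := by simpa using e2
    rw [hβ, this, zero_smul]
  -- `(s, -r)` is a zero of the linear factor with coefficients `r, s`.
  have hiso : A.bracket (s • a + (-r) • b) (s • a + (-r) • b) = 0 := by
    simp only [map_add, map_smul, LinearMap.add_apply, LinearMap.smul_apply, hba, hα, hβ, hγ]
    match_scalars
    linear_combination s ^ 2 * e1 - r * s * e2 + r ^ 2 * e3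
  obtain ⟨a', h⟩ := h.exists_odd₂ (add_mem (Submodule.smul_mem _ _ h.odd₁)
    (Submodule.smul_mem _ _ h.odd₂)) (h.ne_zero_odd hrs)
  generalize s • a + (-r) • b = b at h hiso
  obtain ⟨α, hα⟩ := hA a' h.odd₁ a' h.odd₁
  obtain ⟨β, hβ⟩ := hA a' h.odd₁ b h.odd₂
  by_cases hβ0 : β = 0
  · have hα0 : α ≠ 0 := by
      rintro rfl
      exact h0' h (by simp [hα]) (by simp [hβ, hβ0]) hiso
    have h' := h.change_even (p := α) (q := 0) (r := 0) (s := 1) (by simpa using hα0)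
    exact h'.isomorphic_d7_d8_d9 (by simp [hα]) (by simp [hβ, hβ0]) hiso
  -- With `[b,b] = 0`, the vector `a + t b` has square `α + 2tβ`, so this `t` makes it isotropic.
  · have h' := (h.change_odd (p := 1) (q := -α / (2 * β)) (r := 0) (s := 1) (by simp)).change_even
      (p := β) (q := 0) (r := 0) (s := 1) (by simpa using hβ0)
    have hba := symm₁₁ h.odd₂ h.odd₁
    refine h'.isomorphic_d6 ?_ ?_ ?_
    · simp only [map_add, map_smul, LinearMap.add_apply, LinearMap.smul_apply, hba, hα, hβ, hiso]
      match_scalars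
      field_simp
      ring
    · simp [hβ, hiso]
    · simpa using hiso

end

end LieSuperalgebra

namespace LieSuperalgebra

section

variable {L : Type*} [AddCommGroup L] [Module ℂ L]
variable {A : LieSuperalgebra L} {a b c d x y z : L}

/-! Algebras with zero odd bracket -/

/-- Normal form of the action of an even element `x` on the odd part. -/
theorem IsFrame.exists_normal_form (h : A.IsFrame a b c d) (hx : x ∈ A.part 0) :
    (∃ p : ℂ, ∀ y ∈ A.part 1, A.bracket x y = p • y) ∨
    ∃ a' b', ∃ p q : ℂ, A.IsFrame a' b' c d ∧
      A.bracket x a' = p • a' ∧ A.bracket x b' = a' + q • b' := by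
  obtain ⟨k, l, ha⟩ := h.exists_odd _ (bracket_mem₀₁ hx h.odd₁)
  obtain ⟨m, n, hb⟩ := h.exists_odd _ (bracket_mem₀₁ hx h.odd₂)
  obtain ⟨a, b, p, y, q, h, ha, hb⟩ : ∃ a' b', ∃ p y q : ℂ, A.IsFrame a' b' c d ∧
      A.bracket x a' = p • a' ∧ A.bracket x b' = y • a' + q • b' := by
    -- the eigenvectors are the zeros of `(s, t) ↦ det (s a + t b, x (s a + t b))`
    obtain ⟨r, s, r', s', e1, e2, e3⟩ := exists_factorization l (n - k) (-m)
    obtain ⟨t, u, htu, he⟩ : ∃ t u : ℂ, (t ≠ 0 ∨ u ≠ 0) ∧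
        l * t ^ 2 + (n - k) * t * u - m * u ^ 2 = 0 := by
      by_cases hrs : s = 0 ∧ r = 0
      · refine ⟨1, 0, by simp, ?_⟩
        rw [e1, hrs.2]; ring
      · refine ⟨s, -r, ?_, ?_⟩
        · by_contra! h0
          exact hrs ⟨h0.1, by simpa using h0.2⟩
        · linear_combination s ^ 2 * e1 - r * s * e2 + r ^ 2 * e3
    obtain ⟨p, hp⟩ : ∃ p : ℂ, A.bracket x (t • a + u • b) = p • (t • a + u • b) := by
      simp only [map_add, map_smul, ha, hb]
      by_cases ht : t = 0
      · have hu : u ≠ 0 := htu.resolve_left (by simp [ht])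
        have hm : m = 0 := by simpa [ht, hu] using he
        refine ⟨n, ?_⟩
        rw [ht, hm]
        module
      · refine ⟨(t * k + u * m) / t, ?_⟩
        match_scalars
        · field_simp
        · field_simp
          linear_combination he
    obtain ⟨b', h'⟩ := h.exists_odd₂ (add_mem (Submodule.smul_mem _ _ h.odd₁)
      (Submodule.smul_mem _ _ h.odd₂)) (h.ne_zero_odd htu)
    obtain ⟨y, q, hyq⟩ := h'.swap_odd.exists_odd _ (bracket_mem₀₁ hx h'.odd₁)
    exact ⟨_, _, p, y, q, h'.swap_odd, hp, hyq⟩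
  by_cases hy : y = 0
  · by_cases hpq : p = q
    · left
      refine ⟨p, fun z hz => ?_⟩
      obtain ⟨s, t, rfl⟩ := h.exists_odd z hz
      rw [map_add, map_smul, map_smul, ha, hb, hy, ← hpq]
      module
    · right
      -- Distinct eigenvalues: the basis `(p - q) a`, `a + b` turns the diagonal matrix into the
      -- triangular form used by `d10`.
      have : p - q ≠ 0 := sub_ne_zero.2 hpq
      refine ⟨_, _, p, q, h.change_odd (p := p - q) (q := 0) (r := 1) (s := 1) (by simpa), ?_, ?_⟩
      · simp [ha, smul_comm p]
      · simp only [map_add, map_smul, ha, hb, hy]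
        module
  · right
    refine ⟨_, _, p, q, h.change_odd (p := y) (q := 0) (r := 0) (s := 1) (by simpa), ?_, ?_⟩
    · simp [ha, smul_comm p]
    · simp [hb]

/-- Only the action of `d` on the odd part is left: a scalar gives `d11`, a nonscalar operator
`d10`. -/
theorem IsFrame.isomorphic_d10_or_d11 (h : A.IsFrame a b c d)
    (h0 : ∀ x ∈ A.part 1, ∀ y ∈ A.part 1, A.bracket x y = 0)
    (hc : ∀ x ∈ A.part 1, A.bracket c x = 0) {r : ℂ} (hcd : A.bracket c d = r • c) :
    ∃ s, A.Isomorphic (TwoTwo.algebra s) := by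
  rcases h.exists_normal_form h.even₂ with ⟨p, hp⟩ | ⟨a, b, p, q, h, hda, hdb⟩
  · refine ⟨.d11 p r, h.isomorphic _ ?_ ?_ ?_ ?_ ?_ ?_ ?_ ?_⟩
    all_goals simp [h0 _ h.odd₁ _ h.odd₁, h0 _ h.odd₁ _ h.odd₂, h0 _ h.odd₂ _ h.odd₂, hc _ h.odd₁,
      hc _ h.odd₂, hp _ h.odd₁, hp _ h.odd₂, hcd, combination, TwoTwo.bracketFormula]
  · refine ⟨.d10 p q r, h.isomorphic _ ?_ ?_ ?_ ?_ ?_ ?_ ?_ ?_⟩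
    all_goals simp [h0 _ h.odd₁ _ h.odd₁, h0 _ h.odd₁ _ h.odd₂, h0 _ h.odd₂ _ h.odd₂, hc _ h.odd₁,
      hc _ h.odd₂, hda, hdb, hcd, combination, TwoTwo.bracketFormula]

/-- The action of `c` is its own commutator with that of `d`. It is therefore not a nonzero scalar,
and the matrix equations force it to be nilpotent. -/
theorem IsFrame.isomorphic_d5 (h : A.IsFrame a b c d)
    (h0 : ∀ x ∈ A.part 1, ∀ y ∈ A.part 1, A.bracket x y = 0)
    (hc : ¬ ∀ x ∈ A.part 1, A.bracket c x = 0) (hcd : A.bracket c d = c) :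
    ∃ s, A.Isomorphic (TwoTwo.algebra s) := by
  rcases h.exists_normal_form h.even₁ with ⟨p, hp⟩ | ⟨a, b, p, q, h, hca, hcb⟩
  · refine absurd (fun x hx => ?_) hc
    have hdx := bracket_mem₀₁ h.even₂ hx
    have := jacobi₀ h.even₁ h.even₂ hx
    rw [hp _ hdx, hcd, hp _ hx, map_smul] at this
    rw [hp _ hx]
    simpa using this
  · obtain ⟨m, n, hda⟩ := h.exists_odd _ (bracket_mem₀₁ h.even₂ h.odd₁)
    obtain ⟨k, l, hdb⟩ := h.exists_odd _ (bracket_mem₀₁ h.even₂ h.odd₂)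
    have ja := jacobi₀ h.even₁ h.even₂ h.odd₁
    have jb := jacobi₀ h.even₁ h.even₂ h.odd₂
    simp only [hcd, hca, hcb, hda, hdb, map_add, map_smul] at ja jb
    obtain ⟨a1, a2⟩ := h.indep_odd (n - p) (n * (q - p)) (by
      linear_combination (norm := module) ja)
    obtain ⟨b1, b2⟩ := h.indep_odd (k * (p - q) + l - m - 1) (-(n + q)) (by
      linear_combination (norm := module) jb)
    have hn : n = 0 := by
      have : n ^ 2 = 0 := by linear_combination (-1 / 2) * (a2 + n * b2 - n * a1)
      simpa using this
    have hp : p = 0 := by linear_combination hn - a1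
    have hq : q = 0 := by linear_combination -b2 - hn
    subst hn hp hq
    have hm : m = l - 1 := by linear_combination -b1
    subst hm
    -- Replacing `d` by `d - k c` removes its off-diagonal entry.
    refine ⟨.d5 l 1, (h.change_even (p := 1) (q := 0) (r := -k) (s := 1) (by simp)).isomorphic _
      ?_ ?_ ?_ ?_ ?_ ?_ ?_ ?_⟩
    all_goals simp [h0 _ h.odd₁ _ h.odd₁, h0 _ h.odd₁ _ h.odd₂, h0 _ h.odd₂ _ h.odd₂, hca, hcb,
      hda, hdb, hcd, bracket_self₀ h.even₁, combination, TwoTwo.bracketFormula]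

/-- An operator commuting with the nonscalar operator `c` on a plane is `w + k c`. By faithfulness
`w ≠ 0`, so the even part acts as the span of the identity and `c`. -/
theorem IsFrame.isomorphic_of_commuting (h : A.IsFrame a b c d)
    (h0 : ∀ x ∈ A.part 1, ∀ y ∈ A.part 1, A.bracket x y = 0)
    (hc : ∀ x ∈ A.part 0, (∀ y ∈ A.part 1, A.bracket x y = 0) → x = 0) (hcd : A.bracket c d = 0)
    {p q : ℂ} (hca : A.bracket c a = p • a) (hcb : A.bracket c b = a + q • b) :
    ∃ s, A.Isomorphic (TwoTwo.algebra s) := by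
  obtain ⟨m, n, hda⟩ := h.exists_odd _ (bracket_mem₀₁ h.even₂ h.odd₁)
  obtain ⟨k, l, hdb⟩ := h.exists_odd _ (bracket_mem₀₁ h.even₂ h.odd₂)
  have ja := jacobi₀ h.even₁ h.even₂ h.odd₁
  have jb := jacobi₀ h.even₁ h.even₂ h.odd₂
  simp only [hcd, hca, hcb, hda, hdb, map_add, map_smul] at ja jb
  have hn := (h.indep_odd n (n * (q - p)) (by
    linear_combination (norm := skip) ja
    simp; module)).1
  have hl := (h.indep_odd (k * (p - q) + l - m) (-n) (by
    linear_combination (norm := skip) jb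
    simp; module)).1
  subst hn
  -- `d - k c` acts as the scalar `w`
  obtain ⟨w, rfl⟩ : ∃ w, m = w + k * p := ⟨m - k * p, by ring⟩
  have hl : l = w + k * q := by linear_combination hl
  subst hl
  have hw : w ≠ 0 := by
    rintro rfl
    have := hc (-k • c + (1 : ℂ) • d)
      (add_mem (Submodule.smul_mem _ _ h.even₁) (Submodule.smul_mem _ _ h.even₂)) (by
        intro y hy
        obtain ⟨s, t, rfl⟩ := h.exists_odd y hy
        simp [hca, hcb, hda, hdb]
        module)
    simpa using (h.indep_even _ _ this).2
  have hcc := bracket_self₀ h.even₁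
  have hdd := bracket_self₀ h.even₂
  have hdc : A.bracket d c = 0 := by rw [skew₀₀ h.even₂ h.even₁, hcd, neg_zero]
  -- The new `d` is `(d - k c)/w`, acting as the identity, and the new `c` is `c` minus `p` times
  -- it, which kills `a`.
  have h' := h.change_even (p := 1 + p * k / w) (q := -p / w) (r := -k / w) (s := 1 / w)
    (by intro h1; field_simp at h1; apply hw; linear_combination h1)
  have hc'a : A.bracket ((1 + p * k / w) • c + (-p / w) • d) a = 0 := by
    simp [hca, hda]
    match_scalars; field_simp; ring
  have hc'b : A.bracket ((1 + p * k / w) • c + (-p / w) • d) b = a + (q - p) • b := by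
    simp [hcb, hdb]
    match_scalars <;> field_simp <;> ring
  have hd'a : A.bracket ((-k / w) • c + (1 / w) • d) a = a := by
    simp [hca, hda]
    match_scalars; field_simp; ring
  have hd'b : A.bracket ((-k / w) • c + (1 / w) • d) b = b := by
    simp [hcb, hdb]
    match_scalars <;> field_simp <;> ring
  have hc'd' : A.bracket ((1 + p * k / w) • c + (-p / w) • d) ((-k / w) • c + (1 / w) • d) = 0 := by
    simp [hcc, hdd, hdc, hcd]
  generalize (1 + p * k / w) • c + (-p / w) • d = c' at *
  generalize (-k / w) • c + (1 / w) • d = d' at *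
  have haa := h0 _ h.odd₁ _ h.odd₁
  have hab := h0 _ h.odd₁ _ h.odd₂
  have hbb := h0 _ h.odd₂ _ h.odd₂
  -- The new `c` has eigenvalues `0` and `q - p`: it is nilpotent in the first case and
  -- diagonalizable in the second.
  by_cases hpq : q - p = 0
  · rw [hpq, zero_smul, add_zero] at hc'b
    refine ⟨.d5 1 0, h'.isomorphic _ ?_ ?_ ?_ ?_ ?_ ?_ ?_ ?_⟩
    all_goals simp [haa, hab, hbb, hc'a, hc'b, hd'a, hd'b, hc'd', combination,
      TwoTwo.bracketFormula]
  · have hd'c' : A.bracket d' c' = 0 := by rw [skew₀₀ h'.even₂ h'.even₁, hc'd', neg_zero]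
    have hc'c' := bracket_self₀ h'.even₁
    refine ⟨.d1, ((h'.change_odd (p := (q - p)⁻¹) (q := 0) (r := 0) (s := 1)
      (by simpa)).change_even (p := (q - p)⁻¹) (q := 1) (r := (q - p)⁻¹) (s := 0)
      (by simpa)).isomorphic _ ?_ ?_ ?_ ?_ ?_ ?_ ?_ ?_⟩
    all_goals simp [haa, hab, hbb, hc'a, hc'b, hd'a, hd'b, hd'c', hc'c', smul_smul, hpq,
      combination, TwoTwo.bracketFormula]
    all_goals module

/-- The cases are: abelian and faithful, abelian with a vector acting by zero, nonabelian with the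
derived line acting by zero or not. Two scalar actions cannot be faithful. -/
theorem IsFrame.isomorphic_of_odd_bracket_eq_zero (h : A.IsFrame a b c d)
    (h0 : ∀ x ∈ A.part 1, ∀ y ∈ A.part 1, A.bracket x y = 0) :
    ∃ s, A.Isomorphic (TwoTwo.algebra s) := by
  by_cases hcd : A.bracket c d = 0
  · have hdc : A.bracket d c = 0 := by rw [skew₀₀ h.even₂ h.even₁, hcd, neg_zero]
    by_cases hker : ∀ x ∈ A.part 0, (∀ y ∈ A.part 1, A.bracket x y = 0) → x = 0
    · rcases h.exists_normal_form h.even₁ with ⟨p, hp⟩ | ⟨a, b, p, q, h, hca, hcb⟩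
      · rcases h.exists_normal_form h.even₂ with ⟨q, hq⟩ | ⟨a, b, q, r, h, hda, hdb⟩
        · have hpq := hker (q • c + (-p) • d)
            (add_mem (Submodule.smul_mem _ _ h.even₁) (Submodule.smul_mem _ _ h.even₂))
            (fun y hy => by simp [hp y hy, hq y hy, smul_comm p])
          have hp0 : p = 0 := by simpa using (h.indep_even _ _ hpq).2
          exact absurd (hker c h.even₁ fun y hy => by simp [hp y hy, hp0]) h.even₁_ne_zero
        · exact h.swap_even.isomorphic_of_commuting h0 hker hdc hda hdb
      · exact h.isomorphic_of_commuting h0 hker hcd hca hcb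
    · push Not at hker
      obtain ⟨x, hx, hxy, hx0⟩ := hker
      obtain ⟨d', h'⟩ := h.exists_even₁ hx hx0
      refine h'.isomorphic_d10_or_d11 h0 hxy (r := 0) ?_
      obtain ⟨p, q, rfl⟩ := h.exists_even x hx
      obtain ⟨r, s, rfl⟩ := h.exists_even d' h'.even₂
      simp [hcd, hdc, bracket_self₀ h.even₁, bracket_self₀ h.even₂]
  · have hw := bracket_mem₀₀ h.even₁ h.even₂
    obtain ⟨d', h'⟩ := h.exists_even₁ hw hcd
    -- the derived algebra of the even part is the line through `[c, d]`
    obtain ⟨r, hr, hr0⟩ : ∃ r : ℂ, A.bracket (A.bracket c d) d' = r • A.bracket c d ∧ r ≠ 0 := by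
      have hdc := skew₀₀ h.even₂ h.even₁
      obtain ⟨p, q, hpq⟩ := h.exists_even _ hw
      obtain ⟨m, n, hmn⟩ := h.exists_even d' h'.even₂
      have hr : A.bracket (A.bracket c d) d' = (p * n - q * m) • A.bracket c d := by
        have : A.bracket (p • c + q • d) (m • c + n • d) = (p * n - q * m) • A.bracket c d := by
          simp [hdc, bracket_self₀ h.even₁, bracket_self₀ h.even₂]
          module
        rwa [← hpq, ← hmn] at this
      refine ⟨_, hr, fun hdet => hcd ?_⟩
      rw [hdet, zero_smul] at hr
      -- If `r` were zero, the basis `[c,d], d'` would commute, so `[c,d]` would vanish.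
      obtain ⟨s, t, hc⟩ := h'.exists_even c h.even₁
      obtain ⟨u, v, hd⟩ := h'.exists_even d h.even₂
      have hr' := skew₀₀ h'.even₂ h'.even₁
      rw [hr] at hr'
      have : A.bracket (s • A.bracket c d + t • d') (u • A.bracket c d + v • d') = 0 := by
        simp only [map_add, map_smul, LinearMap.add_apply, LinearMap.smul_apply,
          bracket_self₀ h'.even₁, bracket_self₀ h'.even₂, hr, hr']
        simp
      rwa [← hc, ← hd] at this
    generalize A.bracket c d = c at *
    by_cases hker : ∀ y ∈ A.part 1, A.bracket c y = 0
    · exact h'.isomorphic_d10_or_d11 h0 hker hr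
    · exact (h'.change_even (p := 1) (q := 0) (r := 0) (s := r⁻¹) (by simpa)).isomorphic_d5 h0
        (by simpa using hker) (by simp [hr, hr0])

/-- The list is complete. -/
theorem HasBidim.exists_isomorphic (h : A.HasBidim 2 2) :
    ∃ s, A.Isomorphic (TwoTwo.algebra s) := by
  obtain ⟨a, b, c, d, h⟩ := h.exists_isFrame
  by_cases h0 : ∀ x ∈ A.part 1, ∀ y ∈ A.part 1, A.bracket x y = 0
  · exact h.isomorphic_of_odd_bracket_eq_zero h0
  · by_cases hA : A.OddBracketOnLine
    · exact h.isomorphic_of_oddBracketOnLine hA h0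
    · exact h.isomorphic_of_not_oddBracketOnLine hA

end

end LieSuperalgebra

/-! ### Isomorphisms within the list: coordinates and explicit base changes -/

namespace LieSuperalgebra

namespace TwoTwo

/-- The even linear map with matrix blocks `g` on the odd part and `h` on the even part. -/
def blockMap (g₁ g₂ g₃ g₄ h₁ h₂ h₃ h₄ : ℂ) (x : Fin 4 → ℂ) : Fin 4 → ℂ :=
  ![g₁ * x 0 + g₂ * x 1, g₃ * x 0 + g₄ * x 1, h₁ * x 2 + h₂ * x 3, h₃ * x 2 + h₄ * x 3]

/-- Isomorphisms between members of the list in coordinates. -/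
theorem exists_blockMap {s t : Entry} (h : (algebra s).Isomorphic (algebra t)) :
    ∃ g₁ g₂ g₃ g₄ h₁ h₂ h₃ h₄ : ℂ, g₁ * g₄ - g₂ * g₃ ≠ 0 ∧ h₁ * h₄ - h₂ * h₃ ≠ 0 ∧
      ∀ x y, blockMap g₁ g₂ g₃ g₄ h₁ h₂ h₃ h₄ (bracketFormula s x y) =
        bracketFormula t (blockMap g₁ g₂ g₃ g₄ h₁ h₂ h₃ h₄ x)
          (blockMap g₁ g₂ g₃ g₄ h₁ h₂ h₃ h₄ y) := by
  obtain ⟨e, he, hb⟩ := h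
  have hodd : ∀ x ∈ part 1, e x ∈ part 1 := he 1
  have heven : ∀ x ∈ part 0, e x ∈ part 0 := he 0
  obtain ⟨g₁, g₃, h1⟩ := eq_of_mem_part_one (hodd ![1, 0, 0, 0] (mem_part_one.2 (by simp)))
  obtain ⟨g₂, g₄, h2⟩ := eq_of_mem_part_one (hodd ![0, 1, 0, 0] (mem_part_one.2 (by simp)))
  obtain ⟨h₁, h₃, h3⟩ := eq_of_mem_part_zero (heven ![0, 0, 1, 0] (mem_part_zero.2 (by simp)))
  obtain ⟨h₂, h₄, h4⟩ := eq_of_mem_part_zero (heven ![0, 0, 0, 1] (mem_part_zero.2 (by simp)))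
  have hE : ∀ x, e x = blockMap g₁ g₂ g₃ g₄ h₁ h₂ h₃ h₄ x := by
    intro x
    have hx : x = x 0 • ![1, 0, 0, 0] + x 1 • ![0, 1, 0, 0] + x 2 • ![0, 0, 1, 0]
        + x 3 • ![0, 0, 0, 1] := by
      ext k; fin_cases k <;> simp
    rw [hx, map_add, map_add, map_add, map_smul, map_smul, map_smul, map_smul, h1, h2, h3, h4]
    ext k; fin_cases k <;> simp [blockMap] <;> ring
  have hinj : ∀ x, blockMap g₁ g₂ g₃ g₄ h₁ h₂ h₃ h₄ x = 0 → x = 0 := by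
    intro x hx
    rw [← hE] at hx
    exact (LinearEquiv.map_eq_zero_iff e).1 hx
  refine ⟨g₁, g₂, g₃, g₄, h₁, h₂, h₃, h₄, fun h0 => ?_, fun h0 => ?_, fun x y => ?_⟩
  -- If the determinant is zero, the vectors built from the adjugate lie in the kernel; hence the
  -- block vanishes, against injectivity.
  · have k1 := hinj ![g₄, -g₃, 0, 0] (by
      ext k; fin_cases k <;> simp [blockMap]
      · linear_combination h0
      · ring)
    have k2 := hinj ![g₂, -g₁, 0, 0] (by
      ext k; fin_cases k <;> simp [blockMap]
      · ring
      · linear_combination -h0)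
    simp at k1 k2
    simpa using hinj ![1, 0, 0, 0] (by simp [blockMap, k1, k2])
  · have k1 := hinj ![0, 0, h₄, -h₃] (by
      ext k; fin_cases k <;> simp [blockMap]
      · linear_combination h0
      · ring)
    have k2 := hinj ![0, 0, h₂, -h₁] (by
      ext k; fin_cases k <;> simp [blockMap]
      · ring
      · linear_combination -h0)
    simp at k1 k2
    simpa using hinj ![0, 0, 1, 0] (by simp [blockMap, k1, k2])
  · have := hb x y
    change e (bracketOf _ x y) = bracketOf _ (e x) (e y) at this
    rwa [bracketOf_eq, bracketOf_eq, hE, hE, hE] at this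

theorem isFrame_standard (s : Entry) :
    (algebra s).IsFrame ![1, 0, 0, 0] ![0, 1, 0, 0] ![0, 0, 1, 0] ![0, 0, 0, 1] where
  odd₁ := mem_part_one.2 (by simp)
  odd₂ := mem_part_one.2 (by simp)
  even₁ := mem_part_zero.2 (by simp)
  even₂ := mem_part_zero.2 (by simp)
  exists_odd := by
    intro x hx
    obtain ⟨a, b, rfl⟩ := eq_of_mem_part_one hx
    exact ⟨a, b, by simp⟩
  exists_even := by
    intro x hx
    obtain ⟨a, b, rfl⟩ := eq_of_mem_part_zero hx
    exact ⟨a, b, by simp⟩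
  indep_odd := by intro s t h; simpa using h
  indep_even := by intro s t h; simpa using h

theorem algebra_bracket (s : Entry) (x y : Fin 4 → ℂ) :
    (algebra s).bracket x y = bracketFormula s x y := bracketOf_eq s x y

theorem SamePoint.isomorphic {s t : Entry} (h : SamePoint s t) :
    (algebra s).Isomorphic (algebra t) := by
  have hs := isFrame_standard s
  cases h with
  | refl => exact ⟨LinearEquiv.refl _ _, fun _ _ hx => hx, fun _ _ => rfl⟩
  | d5 u p q hu =>
    refine (hs.change_even (p := 1) (q := 0) (r := 0) (s := u) (by simpa)).isomorphic _
      ?_ ?_ ?_ ?_ ?_ ?_ ?_ ?_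
    all_goals simp [algebra_bracket, bracketFormula, combination]
    all_goals ring
  | d6 u p q hu =>
    refine (hs.change_even (p := 1) (q := 0) (r := 0) (s := u) (by simpa)).isomorphic _
      ?_ ?_ ?_ ?_ ?_ ?_ ?_ ?_
    all_goals simp [algebra_bracket, bracketFormula, combination]
    all_goals ring_nf
    all_goals trivial
  | d6_swap u p q hu =>
    -- The isotropic lines of `d6` are spanned by `v2` and `v1 - 2 v2`, with eigenvalues `p` and `q`
    -- under `v4`; this base change exchanges them.
    refine ((hs.change_odd (p := 2) (q := 0) (r := 1) (s := -2) (by norm_num)).change_even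
      (p := 4) (q := 0) (r := 0) (s := u) (by simpa)).isomorphic _ ?_ ?_ ?_ ?_ ?_ ?_ ?_ ?_
    all_goals simp [algebra_bracket, bracketFormula, combination]
    all_goals ring_nf
    all_goals trivial
  | d7 u p q hu =>
    refine ((hs.change_odd (p := 1) (q := 0) (r := 0) (s := u) (by simpa)).change_even
      (p := 1) (q := 0) (r := 0) (s := u) (by simpa)).isomorphic _ ?_ ?_ ?_ ?_ ?_ ?_ ?_ ?_
    all_goals simp [algebra_bracket, bracketFormula, combination]
    all_goals ring_nf
  | d10 u p q r hu =>
    refine ((hs.change_odd (p := u) (q := 0) (r := 0) (s := 1) (by simpa)).change_even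
      (p := 1) (q := 0) (r := 0) (s := u) (by simpa)).isomorphic _ ?_ ?_ ?_ ?_ ?_ ?_ ?_ ?_
    all_goals simp [algebra_bracket, bracketFormula, combination]
    all_goals ring_nf
  | d10_swap u p q r hu =>
    -- `v1 + (q - p) v2` is an eigenvector of `v4` with eigenvalue `q`; it takes over the role of
    -- `v1`.
    refine ((hs.change_odd (p := u) (q := u * (q - p)) (r := 0) (s := 1) (by simpa)).change_even
      (p := 1) (q := 0) (r := 0) (s := u) (by simpa)).isomorphic _ ?_ ?_ ?_ ?_ ?_ ?_ ?_ ?_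
    all_goals simp [algebra_bracket, bracketFormula, combination]
    all_goals ring_nf
    all_goals trivial
  | d11 u p q hu =>
    refine (hs.change_even (p := 1) (q := 0) (r := 0) (s := u) (by simpa)).isomorphic _
      ?_ ?_ ?_ ?_ ?_ ?_ ?_ ?_
    all_goals simp [algebra_bracket, bracketFormula, combination]
    all_goals ring
  | d5_d10 =>
    -- Both algebras have, up to sign, a single nonzero bracket: `[v3,v2] = v1` in one and `[v4,v2]
    -- = v1` in the other.
    refine hs.swap_even.isomorphic _ ?_ ?_ ?_ ?_ ?_ ?_ ?_ ?_
    all_goals simp [algebra_bracket, bracketFormula, combination]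
  | d10_d5 =>
    refine hs.swap_even.isomorphic _ ?_ ?_ ?_ ?_ ?_ ?_ ?_ ?_
    all_goals simp [algebra_bracket, bracketFormula, combination]

end TwoTwo

end LieSuperalgebra

/-! ### Inverse isomorphisms and transport of extensions -/

namespace LieSuperalgebra

section

variable {L L' : Type*} [AddCommGroup L] [Module ℂ L] [AddCommGroup L'] [Module ℂ L']
variable {A : LieSuperalgebra L} {B : LieSuperalgebra L'}

/-- `Isomorphic` only asks that the parts be mapped into the parts; complementarity gives the
converse, so that inverses preserve the grading. -/
theorem mem_part_of_map_mem (e : L ≃ₗ[ℂ] L') (he : ∀ i, ∀ x ∈ A.part i, e x ∈ B.part i)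
    (i : ZMod 2) (x : L) (hx : e x ∈ B.part i) : x ∈ A.part i := by
  obtain ⟨y, hy, z, hz, rfl⟩ := Submodule.mem_sup.1
    (show x ∈ A.part 0 ⊔ A.part 1 by rw [A.isCompl.sup_eq_top]; trivial)
  have hdisj := Submodule.disjoint_def.1 B.isCompl.disjoint
  revert hx
  refine TwoTwo.zmodTwo_cases
    (P := fun i => e (y + z) ∈ B.part i → y + z ∈ A.part i) (fun hx => ?_) (fun hx => ?_) i
  · rw [map_add, add_mem_cancel_left (he 0 y hy)] at hx
    rw [(LinearEquiv.map_eq_zero_iff e).1 (hdisj _ hx (he 1 z hz)), add_zero]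
    exact hy
  · rw [map_add, add_mem_cancel_right (he 1 z hz)] at hx
    rw [(LinearEquiv.map_eq_zero_iff e).1 (hdisj _ (he 0 y hy) hx), zero_add]
    exact hz

theorem Isomorphic.symm (h : A.Isomorphic B) : B.Isomorphic A := by
  obtain ⟨e, he, hb⟩ := h
  refine ⟨e.symm, fun i x hx => ?_, fun x y => ?_⟩
  · exact mem_part_of_map_mem e he i _ (by simpa using hx)
  · rw [LinearEquiv.symm_apply_eq, hb]
    simp

theorem IsExtensionOfTrivialBy.of_isomorphic {m n : ℕ} (h : A.Isomorphic B)
    (hB : B.IsExtensionOfTrivialBy m n) : A.IsExtensionOfTrivialBy m n := by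
  obtain ⟨e, he, hb⟩ := h
  obtain ⟨M, ⟨hM, hideal⟩, hm, hn, hbr⟩ := hB
  have hpart : ∀ i, (M.comap (e : L →ₗ[ℂ] L')) ⊓ A.part i =
      (M ⊓ B.part i).comap (e : L →ₗ[ℂ] L') := by
    intro i
    ext x
    exact ⟨fun hx => ⟨hx.1, he i x hx.2⟩, fun hx => ⟨hx.1, mem_part_of_map_mem e he i x hx.2⟩⟩
  have hrank : ∀ N : Submodule ℂ L', Module.finrank ℂ (N.comap (e : L →ₗ[ℂ] L')) =
      Module.finrank ℂ N := by
    intro N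
    rw [Submodule.comap_equiv_eq_map_symm]
    exact LinearEquiv.finrank_map_eq e.symm N
  refine ⟨M.comap (e : L →ₗ[ℂ] L'), ⟨?_, fun x y hy => ?_⟩, ?_, ?_, fun x y => ?_⟩
  · rw [hpart, hpart]
    simp only [Submodule.comap_equiv_eq_map_symm]
    rw [← Submodule.map_sup, ← hM]
  · change e (A.bracket x y) ∈ M
    rw [hb]
    exact hideal _ _ hy
  · rw [hpart, hrank, hm]
  · rw [hpart, hrank, hn]
  · change e (A.bracket x y) ∈ M
    rw [hb]
    exact hbr _ _

end

/-! ### Necessary conditions for an isomorphism between members of the list -/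

namespace TwoTwo

/-- The equations satisfied by the matrix of an isomorphism between members of the list. -/
theorem exists_blockMap_basis {s t : Entry} (h : (algebra s).Isomorphic (algebra t)) :
    ∃ g₁ g₂ g₃ g₄ h₁ h₂ h₃ h₄ : ℂ, g₁ * g₄ - g₂ * g₃ ≠ 0 ∧ h₁ * h₄ - h₂ * h₃ ≠ 0 ∧
      ∃ F, F = blockMap g₁ g₂ g₃ g₄ h₁ h₂ h₃ h₄ ∧
        F (bracketFormula s ![1, 0, 0, 0] ![1, 0, 0, 0]) =
          bracketFormula t (F ![1, 0, 0, 0]) (F ![1, 0, 0, 0]) ∧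
        F (bracketFormula s ![1, 0, 0, 0] ![0, 1, 0, 0]) =
          bracketFormula t (F ![1, 0, 0, 0]) (F ![0, 1, 0, 0]) ∧
        F (bracketFormula s ![0, 1, 0, 0] ![0, 1, 0, 0]) =
          bracketFormula t (F ![0, 1, 0, 0]) (F ![0, 1, 0, 0]) ∧
        F (bracketFormula s ![0, 0, 1, 0] ![1, 0, 0, 0]) =
          bracketFormula t (F ![0, 0, 1, 0]) (F ![1, 0, 0, 0]) ∧
        F (bracketFormula s ![0, 0, 1, 0] ![0, 1, 0, 0]) =
          bracketFormula t (F ![0, 0, 1, 0]) (F ![0, 1, 0, 0]) ∧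
        F (bracketFormula s ![0, 0, 0, 1] ![1, 0, 0, 0]) =
          bracketFormula t (F ![0, 0, 0, 1]) (F ![1, 0, 0, 0]) ∧
        F (bracketFormula s ![0, 0, 0, 1] ![0, 1, 0, 0]) =
          bracketFormula t (F ![0, 0, 0, 1]) (F ![0, 1, 0, 0]) ∧
        F (bracketFormula s ![0, 0, 1, 0] ![0, 0, 0, 1]) =
          bracketFormula t (F ![0, 0, 1, 0]) (F ![0, 0, 0, 1]) := by
  obtain ⟨g₁, g₂, g₃, g₄, h₁, h₂, h₃, h₄, hg, hh, h⟩ := exists_blockMap h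
  exact ⟨g₁, g₂, g₃, g₄, h₁, h₂, h₃, h₄, hg, hh, _, rfl, h _ _, h _ _, h _ _, h _ _, h _ _,
    h _ _, h _ _, h _ _⟩

/-- The number of the family that a name belongs to. -/
def Entry.family : Entry → ℕ
  | .d1 => 1
  | .d2 => 2
  | .d3 => 3
  | .d4 => 4
  | .d5 _ _ => 5
  | .d6 _ _ => 6
  | .d7 _ _ => 7
  | .d8 => 8
  | .d9 => 9
  | .d10 _ _ _ => 10
  | .d11 _ _ => 11

-- For each pair of families the block equations, with both determinants nonzero, are inconsistent
-- or force the exceptional pair. Symmetry of isomorphism makes one order of the families enough.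
set_option maxHeartbeats 8000000 in
theorem eq_of_isomorphic_of_family_lt {s t : Entry} (h : (algebra s).Isomorphic (algebra t))
    (hst : s.family < t.family) : s = .d5 0 0 ∧ t = .d10 0 0 0 := by
  obtain ⟨g₁, g₂, g₃, g₄, h₁, h₂, h₃, h₄, hg, hh, F, rfl, h⟩ := exists_blockMap_basis h
  cases s <;> cases t <;>
    first
    | (simp [Entry.family] at hst; done)
    | clear hst
      simp [bracketFormula, blockMap] at h
      first
      | (exfalso; grind)
      | grind

/-- The coefficient `h₄` of `v4` in the image of `v4` is the inverse of the scaling factor; the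
second alternative covers `(0:0)`. -/
theorem d5_of_isomorphic {p q p' q' : ℂ}
    (h : (algebra (.d5 p q)).Isomorphic (algebra (.d5 p' q'))) :
    ∃ u : ℂ, u ≠ 0 ∧ p' = u * p ∧ q' = u * q := by
  obtain ⟨g₁, g₂, g₃, g₄, h₁, h₂, h₃, h₄, hg, hh, F, rfl, h⟩ := exists_blockMap_basis h
  simp [bracketFormula, blockMap] at h
  have : (h₄ ≠ 0 ∧ p = h₄ * p' ∧ q = h₄ * q') ∨ (p = 0 ∧ p' = 0 ∧ q = 0 ∧ q' = 0) := by
    grind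
  rcases this with ⟨h0, rfl, rfl⟩ | h
  · exact ⟨h₄⁻¹, inv_ne_zero h0, by field_simp, by field_simp⟩
  · exact ⟨1, one_ne_zero, by simp [h]⟩

/-- The image of `v2` is an eigenvector of `h₄ v4` with eigenvalue `p`. A nonzero `v1`-component
`g₂` forces `p = h₄ q'`, a zero one `p = h₄ p'`; the action on `v3` fixes `p + q`. -/
theorem d6_of_isomorphic {p q p' q' : ℂ}
    (h : (algebra (.d6 p q)).Isomorphic (algebra (.d6 p' q'))) :
    ∃ u : ℂ, u ≠ 0 ∧ (p' = u * p ∧ q' = u * q ∨ p' = u * q ∧ q' = u * p) := by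
  obtain ⟨g₁, g₂, g₃, g₄, h₁, h₂, h₃, h₄, hg, hh, F, rfl, h⟩ := exists_blockMap_basis h
  simp [bracketFormula, blockMap] at h
  obtain ⟨⟨-, e₁⟩, -, e₂, -, -, -, ⟨e₃, e₄⟩, e₅, -⟩ := h
  rw [e₁, mul_zero, sub_zero] at hh
  rw [e₁, zero_mul, sub_zero] at e₅
  have hh₁ : h₁ ≠ 0 := left_ne_zero_of_mul hh
  have hh₄ : h₄ ≠ 0 := right_ne_zero_of_mul hh
  have hsum : p + q = h₄ * (p' + q') := by
    apply mul_left_cancel₀ hh₁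
    linear_combination -e₅
  by_cases hg₂ : g₂ = 0
  · rw [hg₂, zero_mul, sub_zero] at hg
    have hp : p = h₄ * p' := by
      apply mul_left_cancel₀ (right_ne_zero_of_mul hg)
      rw [hg₂] at e₄
      linear_combination e₄
    have hq : q = h₄ * q' := by linear_combination hsum - hp
    exact ⟨h₄⁻¹, inv_ne_zero hh₄, .inl ⟨by rw [hp]; field_simp, by rw [hq]; field_simp⟩⟩
  · have hp : p = h₄ * q' := by
      apply mul_left_cancel₀ hg₂
      linear_combination e₃
    have hq : q = h₄ * p' := by linear_combination hsum - hp
    exact ⟨h₄⁻¹, inv_ne_zero hh₄, .inr ⟨by rw [hq]; field_simp, by rw [hp]; field_simp⟩⟩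

theorem d7_of_isomorphic {p q p' q' : ℂ}
    (h : (algebra (.d7 p q)).Isomorphic (algebra (.d7 p' q'))) :
    ∃ u : ℂ, u ≠ 0 ∧ p' = u * p ∧ q' = u * q := by
  obtain ⟨g₁, g₂, g₃, g₄, h₁, h₂, h₃, h₄, hg, hh, F, rfl, h⟩ := exists_blockMap_basis h
  simp [bracketFormula, blockMap] at h
  have : h₄ ≠ 0 ∧ p = h₄ * p' ∧ q = h₄ * q' := by
    grind
  obtain ⟨h0, rfl, rfl⟩ := this
  exact ⟨h₄⁻¹, inv_ne_zero h0, by field_simp, by field_simp⟩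

theorem d10_of_isomorphic {p q r p' q' r' : ℂ}
    (h : (algebra (.d10 p q r)).Isomorphic (algebra (.d10 p' q' r'))) :
    ∃ u : ℂ, u ≠ 0 ∧ (p' = u * p ∧ q' = u * q ∧ r' = u * r ∨
      p' = u * q ∧ q' = u * p ∧ r' = u * r) := by
  obtain ⟨g₁, g₂, g₃, g₄, h₁, h₂, h₃, h₄, hg, hh, F, rfl, h⟩ := exists_blockMap_basis h
  simp [bracketFormula, blockMap] at h
  have : (h₄ ≠ 0 ∧ (p = h₄ * p' ∧ q = h₄ * q' ∧ r = h₄ * r' ∨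
      p = h₄ * q' ∧ q = h₄ * p' ∧ r = h₄ * r')) ∨
      (p = 0 ∧ p' = 0 ∧ q = 0 ∧ q' = 0 ∧ r = 0 ∧ r' = 0) := by
    grind
  rcases this with ⟨h0, ⟨rfl, rfl, rfl⟩ | ⟨rfl, rfl, rfl⟩⟩ | h
  · exact ⟨h₄⁻¹, inv_ne_zero h0, .inl ⟨by field_simp, by field_simp, by field_simp⟩⟩
  · exact ⟨h₄⁻¹, inv_ne_zero h0, .inr ⟨by field_simp, by field_simp, by field_simp⟩⟩
  · exact ⟨1, one_ne_zero, by simp [h]⟩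

theorem d11_of_isomorphic {p q p' q' : ℂ}
    (h : (algebra (.d11 p q)).Isomorphic (algebra (.d11 p' q'))) :
    ∃ u : ℂ, u ≠ 0 ∧ p' = u * p ∧ q' = u * q := by
  obtain ⟨g₁, g₂, g₃, g₄, h₁, h₂, h₃, h₄, hg, hh, F, rfl, h⟩ := exists_blockMap_basis h
  simp [bracketFormula, blockMap] at h
  have : (h₄ ≠ 0 ∧ p = h₄ * p' ∧ q = h₄ * q') ∨ (p = 0 ∧ p' = 0 ∧ q = 0 ∧ q' = 0) := by
    grind
  rcases this with ⟨h0, rfl, rfl⟩ | h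
  · exact ⟨h₄⁻¹, inv_ne_zero h0, by field_simp, by field_simp⟩
  · exact ⟨1, one_ne_zero, by simp [h]⟩

theorem SamePoint.of_isomorphic {s t : Entry} (h : (algebra s).Isomorphic (algebra t)) :
    SamePoint s t := by
  rcases lt_trichotomy s.family t.family with hst | hst | hst
  · obtain ⟨rfl, rfl⟩ := eq_of_isomorphic_of_family_lt h hst
    exact .d5_d10
  · cases s <;> cases t <;> first
      | (simp [Entry.family] at hst; done)
      | exact .refl _
      | skip
    · obtain ⟨u, hu, rfl, rfl⟩ := d5_of_isomorphic h
      exact .d5 u _ _ hu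
    · obtain ⟨u, hu, ⟨rfl, rfl⟩ | ⟨rfl, rfl⟩⟩ := d6_of_isomorphic h
      exacts [.d6 u _ _ hu, .d6_swap u _ _ hu]
    · obtain ⟨u, hu, rfl, rfl⟩ := d7_of_isomorphic h
      exact .d7 u _ _ hu
    · obtain ⟨u, hu, ⟨rfl, rfl, rfl⟩ | ⟨rfl, rfl, rfl⟩⟩ := d10_of_isomorphic h
      exacts [.d10 u _ _ _ hu, .d10_swap u _ _ _ hu]
    · obtain ⟨u, hu, rfl, rfl⟩ := d11_of_isomorphic h
      exact .d11 u _ _ hu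
  · obtain ⟨rfl, rfl⟩ := eq_of_isomorphic_of_family_lt h.symm hst
    exact .d10_d5

end TwoTwo

end LieSuperalgebra

/-! ### Graded ideals of codimension one containing all brackets -/

namespace LieSuperalgebra

namespace TwoTwo

/-- The subspace of the vectors supported in `S`. -/
def coordinateSubspace (S : Set (Fin 4)) : Submodule ℂ (Fin 4 → ℂ) :=
  ⨅ k ∈ Sᶜ, LinearMap.ker (LinearMap.proj k : (Fin 4 → ℂ) →ₗ[ℂ] ℂ)

theorem mem_coordinateSubspace {S : Set (Fin 4)} {x : Fin 4 → ℂ} :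
    x ∈ coordinateSubspace S ↔ ∀ k, k ∉ S → x k = 0 := by
  simp [coordinateSubspace]

theorem finrank_coordinateSubspace (S : Set (Fin 4)) [DecidablePred (· ∈ S)] :
    Module.finrank ℂ (coordinateSubspace S) = Fintype.card S := by
  -- The intersection of the kernels of the other coordinates is a product of copies of `ℂ` indexed
  -- by `S`.
  rw [coordinateSubspace, (LinearMap.iInfKerProjEquiv ℂ (fun _ : Fin 4 => ℂ)
    (disjoint_compl_right (a := S)) (by simp)).finrank_eq]
  simp

theorem part_eq_coordinateSubspace (i : ZMod 2) :
    part i = coordinateSubspace {k | parity k = i} := by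
  ext x
  rw [mem_coordinateSubspace]
  rfl

theorem coordinateSubspace_inf (S T : Set (Fin 4)) :
    coordinateSubspace S ⊓ coordinateSubspace T = coordinateSubspace (S ∩ T) := by
  ext x
  simp only [Submodule.mem_inf, mem_coordinateSubspace, Set.mem_inter_iff]
  grind

theorem hasBidim (s : Entry) : (algebra s).HasBidim 2 2 := by
  constructor
  · change Module.finrank ℂ (part 0) = 2
    rw [part_eq_coordinateSubspace, finrank_coordinateSubspace]
    decide
  · change Module.finrank ℂ (part 1) = 2
    rw [part_eq_coordinateSubspace, finrank_coordinateSubspace]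
    decide

/-- A coordinate hyperplane that contains all brackets is a graded ideal. -/
theorem isExtensionOfTrivialBy_of_bracket_apply_eq_zero (s : Entry) (l : Fin 4)
    (h : ∀ x y, bracketFormula s x y l = 0) :
    (algebra s).IsExtensionOfTrivialBy (Fintype.card {k | k ≠ l ∧ parity k = 0})
      (Fintype.card {k | k ≠ l ∧ parity k = 1}) := by
  have hmem : ∀ x y, (algebra s).bracket x y ∈ coordinateSubspace {k | k ≠ l} := by
    intro x y
    rw [mem_coordinateSubspace, algebra_bracket]
    intro k hk
    rw [not_not.1 hk, h]
  have hpart : ∀ i, coordinateSubspace {k | k ≠ l} ⊓ (algebra s).part i =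
      coordinateSubspace {k | k ≠ l ∧ parity k = i} := by
    intro i
    change _ ⊓ part i = _
    rw [part_eq_coordinateSubspace, coordinateSubspace_inf]
    rfl
  refine ⟨_, ⟨le_antisymm ?_ (sup_le inf_le_left inf_le_left), fun x y _ => hmem x y⟩, ?_, ?_, hmem⟩
  · intro x hx
    rw [mem_coordinateSubspace] at hx
    rw [Submodule.mem_sup]
    refine ⟨![0, 0, x 2, x 3], ⟨?_, mem_part_zero.2 (by simp)⟩, ![x 0, x 1, 0, 0],
      ⟨?_, mem_part_one.2 (by simp)⟩, by ext k; fin_cases k <;> simp⟩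
    all_goals
      rw [SetLike.mem_coe, mem_coordinateSubspace]
      intro k hk
      have hxk := hx k hk
      clear * - hxk
      fin_cases k <;> simp_all
  · rw [hpart, finrank_coordinateSubspace]
  · rw [hpart, finrank_coordinateSubspace]

/-- No bracket has a `v4`-component except in `d2`, `d3`, `d4`, where none has a `v1`-component.
Omitting `v4` leaves `1|2`, omitting `v1` leaves `2|1`. -/
theorem isExtensionOfTrivialBy (s : Entry) :
    (algebra s).IsExtensionOfTrivialBy 1 2 ∨ (algebra s).IsExtensionOfTrivialBy 2 1 := by
  have h3 : (∀ x y, bracketFormula s x y 3 = 0) → (algebra s).IsExtensionOfTrivialBy 1 2 :=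
    isExtensionOfTrivialBy_of_bracket_apply_eq_zero s 3
  have h0 : (∀ x y, bracketFormula s x y 0 = 0) → (algebra s).IsExtensionOfTrivialBy 2 1 :=
    isExtensionOfTrivialBy_of_bracket_apply_eq_zero s 0
  cases s <;> first
    | exact Or.inl (h3 fun _ _ => rfl)
    | exact Or.inr (h0 fun _ _ => rfl)

end TwoTwo

end LieSuperalgebra

theorem mainTheorem1 :
    -- every algebra in the list has bidimension 2|2
    (∀ s : LieSuperalgebra.TwoTwo.Entry, (LieSuperalgebra.TwoTwo.algebra s).HasBidim 2 2) ∧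
    -- the list is complete
    (∀ (L : Type*) [AddCommGroup L] [Module ℂ L] (A : LieSuperalgebra L), A.HasBidim 2 2 →
      ∃ s : LieSuperalgebra.TwoTwo.Entry, A.Isomorphic (LieSuperalgebra.TwoTwo.algebra s)) ∧
    -- the isomorphisms between members of the list are exactly the stated ones
    (∀ s t : LieSuperalgebra.TwoTwo.Entry,
      (LieSuperalgebra.TwoTwo.algebra s).Isomorphic (LieSuperalgebra.TwoTwo.algebra t) ↔
        LieSuperalgebra.TwoTwo.SamePoint s t) ∧
    -- every algebra is an extension of a trivial one-dimensional algebra, even or odd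
    (∀ (L : Type*) [AddCommGroup L] [Module ℂ L] (A : LieSuperalgebra L), A.HasBidim 2 2 →
      A.IsExtensionOfTrivialBy 1 2 ∨ A.IsExtensionOfTrivialBy 2 1) := by
  refine ⟨LieSuperalgebra.TwoTwo.hasBidim, fun L _ _ A hA => hA.exists_isomorphic,
    fun s t => ⟨LieSuperalgebra.TwoTwo.SamePoint.of_isomorphic,
      LieSuperalgebra.TwoTwo.SamePoint.isomorphic⟩, fun L _ _ A hA => ?_⟩
  obtain ⟨s, hs⟩ := hA.exists_isomorphic
  exact (LieSuperalgebra.TwoTwo.isExtensionOfTrivialBy s).imp (.of_isomorphic hs)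
    (.of_isomorphic hs)
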